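/- Let $d\in\mathbb N$ and $b\in\mathbb R^d$, and let $\mu,\nu$ be Borel probability measures on $\mathbb R^d$ with finite first moments and common barycentre $\int x\,\mu(dx)=\int y\,\nu(dy)=b$. Let $X,Y$ be their (closed) supports. Let $\mathsf c:X\times Y\times\mathbb R^d\to\mathbb R\cup\{+\infty\}$ satisfy: (H1) $\mathsf c$ is jointly lower semi-continuous and bounded from below; (H2) $z\mapsto \mathsf c(x,y,z)$ is convex for every $(x,y)\in X\times Y$; (H3) there is a convex function $h:\mathbb R^d\to\mathbb R$ with $h(z)/|z|\to+\infty$ as $|z|\to\infty$ such that $\mathsf c(x,y,z)\ge h(z)$ for all $(x,y,z)\in X\times Y\times\mathbb R^d$. Write $\mathcal M(X\times Y;\mathbb R^k)$ for the finite $\mathbb R^k$-valued Borel measures on $\mathbb R^d\times\mathbb R^d$ with support contained in $X\times Y$; weak convergence of measures is understood in duality with bounded continuous functions. Let $\Gamma(\mu,\nu)$ be the set of probability measures $\gamma$ on $X\times Y$ with marginals $\mu$ and $\nu$, let $Q(\mu,\nu)$ be the set of $q\in\mathcal M(X\times Y;\mathbb R^d)$ with marginals $\pi_1\#q=x\,\mu$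 and $\pi_2\#q=y\,\nu$, and let $\Gamma Q(\mu,\nu)=\{(\gamma,q)\in\Gamma(\mu,\nu)\times Q(\mu,\nu): q\ll\gamma\}$. Then: (i) The functional $\mathcal M(X\times Y;\mathbb R\times\mathbb R^d)\to\mathbb R\cup\{+\infty\}$, $$(\gamma,q)\mapsto\begin{cases}\displaystyle\iint \mathsf c\Big(x,y,\frac{dq}{d\gamma}(x,y)\Big)\gamma(dx\,dy)&\text{if }\gamma\ge0\text{ and }q\ll\gamma,\\ +\infty&\text{otherwise,}\end{cases}$$ is convex and lower semi-continuous for the topology of weak convergence. (ii) For every $C_0\in\mathbb R$ the set $$\Big\{(\gamma,q)\in\Gamma Q(\mu,\nu):\iint \mathsf c\Big(x,y,\frac{dq}{d\gamma}(x,y)\Big)\gamma(dx\,dy)\le C_0\Big\}$$ is compact for the topology of weak convergence in $\mathcal M(\mathbb R^d\times\mathbb R^d;\mathbb R\times\mathbb R^d)$. (iii) If the infimum $$\inf\Big\{\iint \mathsf c\Big(x,y,\frac{dq}{d\gamma}(x,y)\Big)\gamma(dx\,dy):(\gamma,q)\in\Gamma Q(\mu,\nu)\Big\}\qquad(\mathrm{M^2OT})$$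 is $<+\infty$, then it is attained by some $(\gamma,q)\in\Gamma Q(\mu,\nu)$. (iv) The solution is in general not unique: for every $d\ge1$ there are $b,\mu,\nu,\mathsf c$ as above for which the infimum in (iii) is $<+\infty$ and is attained by at least two different pairs. -/

import Mathlib

open MeasureTheory Set Filter Topology
open scoped ENNReal BoundedContinuousFunction

namespace BiMOT

noncomputable section

/-- The Euclidean space `ℝ^d`. -/
abbrev Euc (d : ℕ) : Type := EuclideanSpace ℝ (Fin d)

/-- The topology of weak convergence on the space of `F`-valued Borel measures on `Ω`: the coarsest
topology for which `σ ↦ ∫ ⟨Φ, dσ⟩` is continuous for every bounded continuous `Φ : Ω → F`. -/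
instance weakTopology {Ω F : Type*} [TopologicalSpace Ω] [MeasurableSpace Ω]
    [NormedAddCommGroup F] [InnerProductSpace ℝ F] : TopologicalSpace (VectorMeasure Ω F) :=
  ⨅ Φ : Ω →ᵇ F, TopologicalSpace.induced
    (fun σ : VectorMeasure Ω F => VectorMeasure.integral σ (fun ω => Φ ω) (innerSL ℝ)) inferInstance

/-- Pairs `(γ, q)` of a real-valued and an `ℝ^d`-valued measure on `ℝ^d × ℝ^d`, that is, the space
`M(ℝ^d × ℝ^d; ℝ × ℝ^d)`. It carries the product of the two weak topologies, which is its own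
topology of weak convergence. -/
abbrev Pairs (d : ℕ) : Type :=
  SignedMeasure (Euc d × Euc d) × VectorMeasure (Euc d × Euc d) (Euc d)

/-- The probability measures on `ℝ^d` with finite first moment and barycentre `b`. -/
def P1 {d : ℕ} (b : Euc d) : Set (ProbabilityMeasure (Euc d)) :=
  {μ | Integrable (fun x : Euc d => x) (μ : Measure (Euc d)) ∧ ∫ x, x ∂(μ : Measure (Euc d)) = b}

/-- The product `X × Y` of the topological supports of `μ` and `ν`. -/
def suppProd {d : ℕ} (μ ν : ProbabilityMeasure (Euc d)) : Set (Euc d × Euc d) :=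
  (μ : Measure (Euc d)).support ×ˢ (ν : Measure (Euc d)).support

/-- The measures on `Ω` that are carried by `S`; for closed `S` in a Euclidean space these are the
measures whose support is contained in `S`. -/
def carriedBy {Ω F : Type*} [MeasurableSpace Ω] [NormedAddCommGroup F] (S : Set Ω) :
    Set (VectorMeasure Ω F) :=
  {σ | σ.variation Sᶜ = 0}

/-- The space `M(X × Y; ℝ × ℝ^d)`, where `X` and `Y` are the supports of `μ` and `ν`. -/
def pairsOn {d : ℕ} (μ ν : ProbabilityMeasure (Euc d)) : Set (Pairs d) :=
  carriedBy (suppProd μ ν) ×ˢ carriedBy (suppProd μ ν)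

/-- The transport plans `Γ(μ, ν)`. -/
def Gam {d : ℕ} (μ ν : ProbabilityMeasure (Euc d)) : Set (SignedMeasure (Euc d × Euc d)) :=
  {γ | γ ∈ carriedBy (suppProd μ ν) ∧ 0 ≤ γ ∧
    γ.map Prod.fst = (μ : Measure (Euc d)).toSignedMeasure ∧
    γ.map Prod.snd = (ν : Measure (Euc d)).toSignedMeasure}

/-- The vector-valued couplings `Q(μ, ν)`: the marginals are `x μ` and `y ν`. -/
def Q {d : ℕ} (μ ν : ProbabilityMeasure (Euc d)) :
    Set (VectorMeasure (Euc d × Euc d) (Euc d)) :=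
  {q | q ∈ carriedBy (suppProd μ ν) ∧
    q.map Prod.fst = (μ : Measure (Euc d)).withDensityᵥ (fun x => x) ∧
    q.map Prod.snd = (ν : Measure (Euc d)).withDensityᵥ (fun y => y)}

/-- The admissible pairs `ΓQ(μ, ν)`. -/
def GamQ {d : ℕ} (μ ν : ProbabilityMeasure (Euc d)) : Set (Pairs d) :=
  {p | p.1 ∈ Gam μ ν ∧ p.2 ∈ Q μ ν ∧ p.2 ≪ᵥ p.1}

/-- The `i`-th coordinate of a vector measure. -/
def coordMeasure {Ω : Type*} [MeasurableSpace Ω] {d : ℕ} (q : VectorMeasure Ω (Euc d))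
    (i : Fin d) : SignedMeasure Ω :=
  q.mapRange (EuclideanSpace.proj (𝕜 := ℝ) i : Euc d →L[ℝ] ℝ).toLinearMap.toAddMonoidHom
    (EuclideanSpace.proj (𝕜 := ℝ) i : Euc d →L[ℝ] ℝ).continuous

/-- The Radon–Nikodym derivative `dq/dm` of an `ℝ^d`-valued measure, taken coordinatewise. -/
def vecRnDeriv {Ω : Type*} [MeasurableSpace Ω] {d : ℕ} (q : VectorMeasure Ω (Euc d))
    (m : Measure Ω) : Ω → Euc d :=
  fun ω => WithLp.toLp 2 (fun i => (coordMeasure q i).rnDeriv m ω)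

/-- `vecRnDeriv` is indeed the Radon–Nikodym derivative. -/
theorem withDensity_vecRnDeriv {Ω : Type*} [MeasurableSpace Ω] {d : ℕ}
    (q : VectorMeasure Ω (Euc d)) (m : Measure Ω) [IsFiniteMeasure m]
    (h : q ≪ᵥ m.toENNRealVectorMeasure) :
    Integrable (vecRnDeriv q m) m ∧ m.withDensityᵥ (vecRnDeriv q m) = q := by
  have hc : ∀ i, m.withDensityᵥ ((coordMeasure q i).rnDeriv m) = coordMeasure q i := fun i =>
    SignedMeasure.withDensityᵥ_rnDeriv_eq _ _ (fun s hs => by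
      change (EuclideanSpace.proj (𝕜 := ℝ) i : Euc d →L[ℝ] ℝ) (q s) = 0
      rw [h hs, map_zero])
  have hint : Integrable (vecRnDeriv q m) m := by
    rw [← (EuclideanSpace.equiv (Fin d) ℝ).integrable_comp_iff]
    exact Integrable.of_eval fun i => SignedMeasure.integrable_rnDeriv _ _
  refine ⟨hint, ?_⟩
  ext s hs i
  rw [withDensityᵥ_apply hint hs]
  have h1 := (EuclideanSpace.proj (𝕜 := ℝ) i : Euc d →L[ℝ] ℝ).integral_comp_comm
    hint.integrableOn (μ := m.restrict s)
  have h2 := congrArg (fun v => v s) (hc i)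
  simp only [withDensityᵥ_apply (SignedMeasure.integrable_rnDeriv _ _) hs] at h2
  calc _ = _ := h1.symm
    _ = _ := h2

/-- A nonnegative signed measure is its own variation, and the variation is finite. -/
theorem variation_of_nonneg {Ω : Type*} [MeasurableSpace Ω] (γ : SignedMeasure Ω) (h : 0 ≤ γ) :
    ∃ _ : IsFiniteMeasure γ.variation, γ.variation.toSignedMeasure = γ := by
  have h0 : 0 ≤[Set.univ] γ := by rwa [VectorMeasure.le_restrict_univ_iff_le]
  have e : γ = (γ.toMeasureOfZeroLE Set.univ MeasurableSet.univ h0).toSignedMeasure :=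
    (SignedMeasure.toMeasureOfZeroLE_toSignedMeasure _ h0).symm
  have e' : γ.variation = γ.toMeasureOfZeroLE Set.univ MeasurableSet.univ h0 := by
    conv_lhs => rw [e]
    simp
  have i : IsFiniteMeasure γ.variation := by rw [e']; infer_instance
  refine ⟨i, ?_⟩
  conv_rhs => rw [e]
  simp_rw [e']

/-- The integral of an extended-real function `f`, as the integral of its positive part minus that
of its negative part. It is used only for `f` bounded from below and `m` finite. -/
def erealIntegral {Ω : Type*} [MeasurableSpace Ω] (m : Measure Ω) (f : Ω → EReal) : EReal :=
  ((∫⁻ ω, (f ω).toENNReal ∂m : ℝ≥0∞) : EReal) - ((∫⁻ ω, (-f ω).toENNReal ∂m : ℝ≥0∞) : EReal)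

/-- The transport cost `∫ c(x, y, dq/dγ(x, y)) γ(dx dy)` of a pair with `γ ≥ 0` and `q ≪ γ`.
For `γ ≥ 0` the variation of `γ` is `γ` itself, as a positive measure. -/
def cost {d : ℕ} (c : Euc d → Euc d → Euc d → EReal) (p : Pairs d) : EReal :=
  erealIntegral p.1.variation (fun ω => c ω.1 ω.2 (vecRnDeriv p.2 p.1.variation ω))

open scoped Classical in
/-- The transport cost extended by `+∞` to all pairs of measures. -/
def functional {d : ℕ} (c : Euc d → Euc d → Euc d → EReal) (p : Pairs d) : EReal :=
  if 0 ≤ p.1 ∧ p.2 ≪ᵥ p.1 then cost c p else ⊤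

/-- Convexity on `s` of a function with values in `ℝ ∪ {+∞}`. -/
def ERealConvexOn {V : Type*} [AddCommGroup V] [Module ℝ V] (s : Set V) (f : V → EReal) : Prop :=
  Convex ℝ s ∧ ∀ ⦃v⦄, v ∈ s → ∀ ⦃w⦄, w ∈ s → ∀ ⦃a b : ℝ⦄, 0 < a → 0 < b → a + b = 1 →
    f (a • v + b • w) ≤ (a : EReal) * f v + (b : EReal) * f w

/-- The standing conditions on a cost `c : X × Y × ℝ^d → ℝ ∪ {+∞}`; the values of `c` off
`X × Y × ℝ^d` are irrelevant. -/
structure CostConditions {d : ℕ} (X Y : Set (Euc d)) (c : Euc d → Euc d → Euc d → EReal) :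
    Prop where
  lsc : LowerSemicontinuousOn (fun p : Euc d × Euc d × Euc d => c p.1 p.2.1 p.2.2)
    (X ×ˢ Y ×ˢ univ)
  bounded_below : ∃ m : ℝ, ∀ x ∈ X, ∀ y ∈ Y, ∀ z, (m : EReal) ≤ c x y z
  convex : ∀ x ∈ X, ∀ y ∈ Y, ERealConvexOn univ (c x y)
  superlinear : ∃ h : Euc d → ℝ, ConvexOn ℝ univ h ∧
    Tendsto (fun z => h z / ‖z‖) (Bornology.cobounded (Euc d)) atTop ∧
    ∀ x ∈ X, ∀ y ∈ Y, ∀ z, (h z : EReal) ≤ c x y z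

/-- The infimum of the bi-martingale optimal transport problem. -/
def infimum {d : ℕ} (c : Euc d → Euc d → Euc d → EReal) (μ ν : ProbabilityMeasure (Euc d)) :
    EReal :=
  ⨅ p ∈ GamQ μ ν, cost c p

/-- The pair `p` solves the bi-martingale optimal transport problem. -/
def IsSolution {d : ℕ} (c : Euc d → Euc d → Euc d → EReal) (μ ν : ProbabilityMeasure (Euc d))
    (p : Pairs d) : Prop :=
  p ∈ GamQ μ ν ∧ cost c p = infimum c μ ν

end

end BiMOT

/-!
The functional is a supremum of weakly continuous linear functionals, which gives convexity and
lower semicontinuity, and its sublevel sets are compact because admissible pairs lift to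
probability measures on `X × Y × ℝ^d`.

*Duality.* Write `C ω z` for the cost, with `ω = (x, y)` in the closed set `S = X × Y`. Consider
the functions `φ(ω) + ⟨ψ(ω), z⟩` with `φ`, `ψ` bounded and continuous that lie below `C` over `S`
(`minorants`). By Hahn–Banach each convex function `C ω₀` is the supremum of its affine minorants,
and by superlinearity an affine minorant of `C ω₀` remains one for `ω ∈ S` near `ω₀` after an
arbitrarily small decrease; a cutoff turns it into an element of `minorants`. So `C` is the
supremum of `minorants`, even of a sequence in it (`SuperlinearIntegrand.exists_seq_minorants`). A
minorant integrates against a pair `(γ, q)` to `pairing = ∫ φ dγ + ∫ ⟨ψ, dq⟩`, which is linear and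
weakly continuous in `(γ, q)`. The maximum of two minorants need not be of the same form, but its
integral is approximated by those of the minorants obtained by interpolating with a continuous
approximation of the indicator of the set where the first one is larger
(`exists_minorant_integral_partialSups_sub_le`). Monotone convergence then shows that the cost of a
pair with `γ ≥ 0` and `q ≪ γ` is the supremum of its pairings. Conversely, if the pairings with
`(γ, q)` are bounded above, then `γ ≥ 0` and `q ≪ γ` (`nonneg_of_forall_pairing_le`,
`absolutelyContinuous_of_forall_pairing_le`), because minorants may be very negative, and by
superlinearity may have arbitrarily large slope, on any given closed set. Together this is
`functional_eq_iSup`.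

*Compactness.* An admissible pair of bounded cost is the image under `youngPair` of the law of
`(x, y, dq/dγ(x, y))` under `γ`. The superlinear growth bounds the moments of the last coordinate, so
this law belongs to a set `youngSet` that is compact by Prokhorov's theorem and on which the last
coordinate is uniformly integrable, whence `youngPair` is continuous on it. A sublevel set is the
intersection of the image of `youngSet` with closed conditions, the bound on the cost being closed
by the duality above. A minimizer exists because a lower semicontinuous function attains its
minimum on a compact sublevel set.

*Non-uniqueness.* For `μ = ν = ½ (δ_e + δ_{-e})` with `‖e‖ = 1`, the vector `⟨x, y⟩ e` has zero
mean given `x` and given `y` under the product coupling. Hence `x + y + t ⟨x, y⟩ e` is the density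
of an admissible `q` for every `t`, and for `|t| ≤ 2` it takes values of norm at most `4`, where
`flatCost` vanishes.
-/

namespace BiMOT

noncomputable section

open scoped RealInnerProductSpace

/-! ### Vector measures and bounded continuous functions -/

theorem mem_carriedBy_iff {Ω F : Type*} [MeasurableSpace Ω] [NormedAddCommGroup F]
    {S : Set Ω} (hS : MeasurableSet S) (σ : VectorMeasure Ω F) :
    σ ∈ carriedBy S ↔ ∀ t ⊆ Sᶜ, MeasurableSet t → σ t = 0 :=
  VectorMeasure.variation_apply_eq_zero hS.compl

section VectorMeasures

variable {Ω F : Type*} [MeasurableSpace Ω] [NormedAddCommGroup F] [InnerProductSpace ℝ F]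

instance isFiniteMeasure_variation_signedMeasure (σ : SignedMeasure Ω) :
    IsFiniteMeasure (VectorMeasure.variation σ) := by
  rw [← SignedMeasure.totalVariation_eq_variation, SignedMeasure.totalVariation]
  infer_instance

theorem coordMeasure_apply {d : ℕ} (q : VectorMeasure Ω (Euc d)) (i : Fin d) (s : Set Ω) :
    coordMeasure q i s = q s i := rfl

/-- In finite dimension every vector measure has finite variation: it is bounded by the sum of the
variations of the coordinates. -/
instance isFiniteMeasure_variation_euc {d : ℕ} (q : VectorMeasure Ω (Euc d)) :
    IsFiniteMeasure q.variation := by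
  have h : q.variation ≤ ∑ i, (coordMeasure q i).variation := by
    refine VectorMeasure.variation_le_of_forall_enorm_le fun s _ => ?_
    have h1 : q s = ∑ i, (q s i) • EuclideanSpace.single i (1 : ℝ) := by
      ext j
      simp [Finset.sum_apply, Pi.single_apply]
    calc ‖q s‖ₑ ≤ ∑ i, ‖(q s i) • EuclideanSpace.single i (1 : ℝ)‖ₑ := by
          conv_lhs => rw [h1]
          exact enorm_sum_le _ _
      _ = ∑ i, ‖coordMeasure q i s‖ₑ := by
          refine Finset.sum_congr rfl fun i _ => ?_
          rw [enorm_smul, coordMeasure_apply]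
          simp [enorm_eq_nnnorm]
      _ ≤ ∑ i, (coordMeasure q i).variation s := by
          gcongr with i
          exact VectorMeasure.enorm_measure_le_variation _ _
      _ = _ := by simp
  exact isFiniteMeasure_of_le _ h

theorem integrable_withDensity_variation {m : Measure Ω} {f : Ω → F} {Φ : Ω → F}
    [CompleteSpace F]
    (hf : Integrable f m) (hΦ : StronglyMeasurable Φ) {K : ℝ} (hK : ∀ ω, ‖Φ ω‖ ≤ K) :
    (m.withDensityᵥ f).Integrable Φ := by
  have : IsFiniteMeasure (m.withDensityᵥ f).variation := by
    rw [Measure.variation_withDensityᵥ hf]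
    exact ⟨by simpa using! hf.2⟩
  exact Integrable.of_bound hΦ.aestronglyMeasurable K (Eventually.of_forall hK)

theorem integrable_inner_of_bounded {m : Measure Ω} {f : Ω → F} {Φ : Ω → F}
    (hf : Integrable f m) (hΦ : StronglyMeasurable Φ) {K : ℝ} (hK : ∀ ω, ‖Φ ω‖ ≤ K) :
    Integrable (fun ω => ⟪Φ ω, f ω⟫) m :=
  Integrable.mono' (hf.norm.const_mul K) (hΦ.aestronglyMeasurable.inner hf.aestronglyMeasurable)
    (Eventually.of_forall fun ω => (norm_inner_le_norm _ _).trans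
      (mul_le_mul_of_nonneg_right (hK ω) (norm_nonneg _)))

/-- Integration of a bounded function against a vector measure with a density. -/
theorem integral_withDensityᵥ_inner [CompleteSpace F] {m : Measure Ω} {f : Ω → F} {Φ : Ω → F}
    (hf : Integrable f m) (hΦ : StronglyMeasurable Φ) {K : ℝ} (hK : ∀ ω, ‖Φ ω‖ ≤ K) :
    (m.withDensityᵥ f).integral Φ (innerSL ℝ) = ∫ ω, ⟪Φ ω, f ω⟫ ∂m := by
  have hfin : IsFiniteMeasure (m.withDensityᵥ f).variation := by
    rw [Measure.variation_withDensityᵥ hf]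
    exact ⟨by simpa using! hf.2⟩
  have bdd : ∀ g : SimpleFunc Ω F, ∃ C, ∀ ω, ‖g ω‖ ≤ C := fun g => g.exists_forall_norm_le
  -- simple functions first; bounded functions by dominated convergence on both sides
  have hsimple : ∀ g : SimpleFunc Ω F,
      (m.withDensityᵥ f).integral g (innerSL ℝ) = ∫ ω, ⟪g ω, f ω⟫ ∂m := by
    intro g
    induction g using SimpleFunc.induction with
    | const c hs =>
      rename_i s
      simp only [SimpleFunc.coe_piecewise, SimpleFunc.coe_const, SimpleFunc.const_zero,
        SimpleFunc.coe_zero, piecewise_eq_indicator]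
      have h2 : ∀ ω, ⟪s.indicator (Function.const Ω c) ω, f ω⟫ =
          s.indicator (fun ω => ⟪c, f ω⟫) ω := fun ω => by
        by_cases h : ω ∈ s <;> simp [h]
      simp_rw [h2]
      rw [VectorMeasure.integral_indicator hs, MeasureTheory.integral_indicator hs]
      have : ∫ᵛ x in s, Function.const Ω c x ∂[innerSL ℝ; m.withDensityᵥ f] =
          ∫ᵛ x in s, c ∂[innerSL ℝ; m.withDensityᵥ f] := rfl
      rw [this, VectorMeasure.integral_const, integral_inner hf.integrableOn]
      simp [VectorMeasure.restrict_apply, hs, withDensityᵥ_apply hf hs, innerSL_apply_apply ℝ]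
    | add _ hg hh =>
      rename_i g h _
      obtain ⟨C, hC⟩ := bdd g
      obtain ⟨D, hD⟩ := bdd h
      rw [SimpleFunc.coe_add, VectorMeasure.integral_add
        (integrable_withDensity_variation hf g.stronglyMeasurable hC)
        (integrable_withDensity_variation hf h.stronglyMeasurable hD), hg, hh]
      simp_rw [Pi.add_apply, inner_add_left]
      rw [integral_add (integrable_inner_of_bounded hf g.stronglyMeasurable hC)
        (integrable_inner_of_bounded hf h.stronglyMeasurable hD)]
  have hK' : ∀ ω, ‖Φ ω‖ ≤ |K| := fun ω => (hK ω).trans (le_abs_self K)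
  set g : ℕ → SimpleFunc Ω F := hΦ.approxBounded |K| with hgdef
  have hgb : ∀ n ω, ‖g n ω‖ ≤ |K| := fun n ω => hΦ.norm_approxBounded_le (abs_nonneg K) n ω
  have hgt : ∀ ω, Tendsto (fun n => g n ω) atTop (𝓝 (Φ ω)) := fun ω =>
    hΦ.tendsto_approxBounded_of_norm_le (hK' ω)
  have h1 : Tendsto (fun n => (m.withDensityᵥ f).integral (g n) (innerSL ℝ)) atTop
      (𝓝 ((m.withDensityᵥ f).integral Φ (innerSL ℝ))) :=
    VectorMeasure.tendsto_integral_filter_of_norm_le_const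
      (Eventually.of_forall fun n => (g n).stronglyMeasurable.aestronglyMeasurable)
      ⟨|K|, Eventually.of_forall fun n => Eventually.of_forall (hgb n)⟩
      (Eventually.of_forall hgt)
  have h2 : Tendsto (fun n => ∫ ω, ⟪g n ω, f ω⟫ ∂m) atTop (𝓝 (∫ ω, ⟪Φ ω, f ω⟫ ∂m)) :=
    tendsto_integral_of_dominated_convergence (fun ω => |K| * ‖f ω‖)
      (fun n => ((g n).stronglyMeasurable.aestronglyMeasurable.inner hf.aestronglyMeasurable))
      (hf.norm.const_mul _)
      (fun n => Eventually.of_forall fun ω => (norm_inner_le_norm _ _).trans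
        (mul_le_mul_of_nonneg_right (hgb n ω) (norm_nonneg _)))
      (Eventually.of_forall fun ω => (hgt ω).inner tendsto_const_nhds)
  simp_rw [hsimple] at h1
  exact tendsto_nhds_unique h1 h2

theorem toSignedMeasure_eq_withDensityᵥ_one (m : Measure Ω) [IsFiniteMeasure m] :
    m.toSignedMeasure = m.withDensityᵥ (fun _ => (1 : ℝ)) := by
  ext s hs
  rw [withDensityᵥ_apply (integrable_const _) hs, Measure.toSignedMeasure_apply_measurable hs]
  simp

theorem integral_toSignedMeasure_innerSL (m : Measure Ω) [IsFiniteMeasure m] {φ : Ω → ℝ}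
    (hφ : StronglyMeasurable φ) {K : ℝ} (hK : ∀ ω, ‖φ ω‖ ≤ K) :
    m.toSignedMeasure.integral φ (innerSL ℝ) = ∫ ω, φ ω ∂m := by
  rw [toSignedMeasure_eq_withDensityᵥ_one, integral_withDensityᵥ_inner (integrable_const _) hφ hK]
  simp

theorem convex_carriedBy {S : Set Ω} (hS : MeasurableSet S) :
    Convex ℝ (carriedBy S : Set (VectorMeasure Ω F)) := by
  intro σ hσ τ hτ a b _ _ _
  rw [mem_carriedBy_iff hS] at *
  intro t ht hm
  simp [hσ t ht hm, hτ t ht hm]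

variable [TopologicalSpace Ω]

theorem continuous_integral_boundedContinuous (Φ : Ω →ᵇ F) :
    Continuous (fun σ : VectorMeasure Ω F => σ.integral (fun ω => Φ ω) (innerSL ℝ)) :=
  continuous_iInf_dom (i := Φ) continuous_induced_dom

theorem continuousOn_weakTopology_iff {T : Type*} [TopologicalSpace T] {s : Set T}
    (g : T → VectorMeasure Ω F) :
    ContinuousOn g s ↔
      ∀ Φ : Ω →ᵇ F, ContinuousOn (fun t => (g t).integral (fun ω => Φ ω) (innerSL ℝ)) s := by
  simp only [continuousOn_iff_continuous_domRestrict]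
  refine continuous_iInf_rng.trans (forall_congr' fun Φ => ?_)
  exact continuous_induced_rng

end VectorMeasures

section Bump

variable {Ω : Type*} [PseudoMetricSpace Ω]

/-- A continuous `[0,1]`-valued function that is `1` on `s` and vanishes at distance at least
`1 / (k + 1)` from `s`. -/
def bump (s : Set Ω) (k : ℕ) : Ω →ᵇ ℝ :=
  (thickenedIndicator (Nat.one_div_pos_of_nat (n := k) (α := ℝ)) s).comp _
    (LipschitzWith.subtype_val (Set.Ici (0 : ℝ)))

theorem bump_nonneg (s : Set Ω) (k : ℕ) (ω : Ω) : 0 ≤ bump s k ω := NNReal.coe_nonneg _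

theorem bump_le_one (s : Set Ω) (k : ℕ) (ω : Ω) : bump s k ω ≤ 1 :=
  NNReal.coe_le_one.2 (thickenedIndicator_le_one _ s ω)

theorem norm_bump_le_one (s : Set Ω) (k : ℕ) (ω : Ω) : ‖bump s k ω‖ ≤ 1 := by
  rw [Real.norm_of_nonneg (bump_nonneg s k ω)]
  exact bump_le_one s k ω

theorem bump_eq_one {s : Set Ω} (k : ℕ) {ω : Ω} (h : ω ∈ s) : bump s k ω = 1 :=
  NNReal.coe_eq_one.2 (thickenedIndicator_one _ s h)

theorem bump_eq_zero {s : Set Ω} {k : ℕ} {ω : Ω} (h : ω ∉ Metric.thickening (1 / ((k : ℝ) + 1)) s) :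
    bump s k ω = 0 :=
  NNReal.coe_eq_zero.2 (thickenedIndicator_zero _ s h)

theorem tendsto_bump {s : Set Ω} (hs : IsClosed s) (ω : Ω) :
    Tendsto (fun k => bump s k ω) atTop (𝓝 (s.indicator (fun _ => (1 : ℝ)) ω)) := by
  have h := thickenedIndicator_tendsto_indicator_closure
    (fun n => Nat.one_div_pos_of_nat (n := n) (α := ℝ)) tendsto_one_div_add_atTop_nhds_zero_nat s
  rw [tendsto_pi_nhds] at h
  have h1 := (NNReal.continuous_coe.tendsto _).comp (h ω)
  rw [hs.closure_eq] at h1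
  have h2 : ((s.indicator (fun _ => 1) ω : NNReal) : ℝ) = s.indicator (fun _ => (1 : ℝ)) ω := by
    by_cases hω : ω ∈ s <;> simp [hω]
  rw [h2] at h1
  exact h1

theorem abs_indicator_sub_bump_le_one (s : Set Ω) (k : ℕ) (ω : Ω) :
    |s.indicator (fun _ => (1 : ℝ)) ω - bump s k ω| ≤ 1 := by
  have h2 := bump_nonneg s k ω
  have h3 := bump_le_one s k ω
  by_cases hω : ω ∈ s
  · rw [indicator_of_mem hω, abs_le]
    constructor <;> linarith
  · rw [indicator_of_notMem hω, abs_le]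
    constructor <;> linarith

end Bump

/-- Inner regularity by closed sets, inherited from the variation measure. -/
theorem exists_isClosed_norm_sub_lt {Ω F : Type*} [MeasurableSpace Ω]
    [PseudoMetricSpace Ω] [BorelSpace Ω] [NormedAddCommGroup F] (σ : VectorMeasure Ω F)
    [IsFiniteMeasure σ.variation] {A : Set Ω} (hA : MeasurableSet A) {ε : ℝ} (hε : 0 < ε) :
    ∃ s ⊆ A, IsClosed s ∧ ‖σ A - σ s‖ < ε := by
  obtain ⟨s, hs, hc, hlt⟩ := hA.exists_isClosed_sdiff_lt (μ := σ.variation) (measure_ne_top _ _)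
    (ENNReal.ofReal_pos.2 hε).ne'
  refine ⟨s, hs, hc, ?_⟩
  have h1 : σ A - σ s = σ (A \ s) := by
    rw [sub_eq_iff_eq_add, add_comm, VectorMeasure.of_add_of_sdiff hc.measurableSet hA hs]
  rw [h1]
  have h2 := (VectorMeasure.enorm_measure_le_variation σ (A \ s)).trans_lt hlt
  rw [← ofReal_norm] at h2
  exact (ENNReal.ofReal_lt_ofReal_iff hε).1 h2

section Regularity

variable {Ω F : Type*} [MeasurableSpace Ω] [PseudoMetricSpace Ω] [BorelSpace Ω]
  [NormedAddCommGroup F] [InnerProductSpace ℝ F]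

theorem tendsto_integral_bump [CompleteSpace F] (σ : VectorMeasure Ω F)
    [IsFiniteMeasure σ.variation] {s : Set Ω} (hs : IsClosed s) (e : F) :
    Tendsto (fun k => σ.integral (fun ω => bump s k ω • e) (innerSL ℝ)) atTop
      (𝓝 ⟪e, σ s⟫) := by
  have h1 : σ.integral (s.indicator fun _ => e) (innerSL ℝ) = ⟪e, σ s⟫ := by
    rw [VectorMeasure.integral_indicator hs.measurableSet, VectorMeasure.integral_const]
    simp [VectorMeasure.restrict_apply, hs.measurableSet, innerSL_apply_apply ℝ]
  rw [← h1]
  refine VectorMeasure.tendsto_integral_filter_of_norm_le_const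
    (Eventually.of_forall fun k => ?_) ⟨‖e‖, Eventually.of_forall fun k => ?_⟩ ?_
  · exact (((bump s k).continuous.stronglyMeasurable).smul_const e).aestronglyMeasurable
  · refine Eventually.of_forall fun ω => ?_
    rw [norm_smul]
    exact mul_le_of_le_one_left (norm_nonneg _) (norm_bump_le_one s k ω)
  · refine Eventually.of_forall fun ω => ?_
    convert (tendsto_bump hs ω).smul_const e using 2
    by_cases hω : ω ∈ s <;> simp [hω]

/-- Bounded continuous functions separate vector measures of finite variation. -/
theorem ext_of_integral_boundedContinuous [CompleteSpace F] {σ τ : VectorMeasure Ω F}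
    [IsFiniteMeasure σ.variation] [IsFiniteMeasure τ.variation]
    (h : ∀ Φ : Ω →ᵇ F, σ.integral (fun ω => Φ ω) (innerSL ℝ) =
      τ.integral (fun ω => Φ ω) (innerSL ℝ)) : σ = τ := by
  have hclosed : ∀ s : Set Ω, IsClosed s → σ s = τ s := by
    intro s hs
    refine ext_inner_left ℝ fun e => ?_
    refine tendsto_nhds_unique (tendsto_integral_bump σ hs e) ?_
    have h1 : ∀ k, σ.integral (fun ω => bump s k ω • e) (innerSL ℝ) =
        τ.integral (fun ω => bump s k ω • e) (innerSL ℝ) := fun k =>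
      h (bump s k • BoundedContinuousFunction.const Ω e)
    simp_rw [h1]
    exact tendsto_integral_bump τ hs e
  have hfin : IsFiniteMeasure (σ - τ).variation :=
    isFiniteMeasure_of_le _ VectorMeasure.variation_sub_le
  ext1 A hA
  by_contra hne
  obtain ⟨s, -, hc, hlt⟩ := exists_isClosed_norm_sub_lt (σ - τ) hA
    (norm_pos_iff.2 (sub_ne_zero.2 hne))
  simp [hclosed s hc] at hlt

end Regularity

/-! ### Affine minorants of the integrand -/

section Minorants

/-- A lower semicontinuous convex function on a Hilbert space that is bounded below by a real number
is, at every point, the supremum of its continuous affine minorants. -/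
theorem exists_affine_minorant {E : Type*} [NormedAddCommGroup E] [InnerProductSpace ℝ E]
    [CompleteSpace E] {g : E → EReal} (hconv : ERealConvexOn univ g) (hlsc : LowerSemicontinuous g)
    {k : ℝ} (hk : ∀ z, (k : EReal) ≤ g z) {z₀ : E} {r : ℝ} (hr : (r : EReal) < g z₀) :
    ∃ (a : ℝ) (v : E), (∀ z, ((a + ⟪v, z⟫ : ℝ) : EReal) ≤ g z) ∧ r < a + ⟪v, z₀⟫ := by
  by_cases htop : ∀ z, g z = ⊤
  · exact ⟨r + 1, 0, fun z => by simp [htop z], by simp⟩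
  push Not at htop
  obtain ⟨z₁, hz₁⟩ := htop
  have hreal : ∀ z, g z ≠ ⊤ → ∃ t : ℝ, g z = t := fun z hz =>
    ⟨(g z).toReal, (EReal.coe_toReal hz (ne_of_gt ((EReal.bot_lt_coe k).trans_le (hk z)))).symm⟩
  let epi : Set (E × ℝ) := {p | g p.1 ≤ (p.2 : EReal)}
  have hepi_closed : IsClosed epi := by
    have h1 : IsClosed {p : E × EReal | g p.1 ≤ p.2} := hlsc.isClosed_epigraph
    exact h1.preimage (continuous_fst.prodMk (continuous_coe_real_ereal.comp continuous_snd))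
  have hepi_convex : Convex ℝ epi := by
    refine convex_iff_forall_pos.2 ?_
    rintro ⟨z, s⟩ hz ⟨w, t⟩ hw a b ha hb hab
    change g (a • z + b • w) ≤ ((a • s + b • t : ℝ) : EReal)
    refine (hconv.2 (mem_univ z) (mem_univ w) ha hb hab).trans ?_
    rw [EReal.coe_add, smul_eq_mul, smul_eq_mul, EReal.coe_mul, EReal.coe_mul]
    exact add_le_add (mul_le_mul_of_nonneg_left hz (EReal.coe_nonneg.2 ha.le))
      (mul_le_mul_of_nonneg_left hw (EReal.coe_nonneg.2 hb.le))
  have hnot : (z₀, r) ∉ epi := fun h => (not_le.2 hr) h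
  obtain ⟨f, u, hfu, huf⟩ := geometric_hahn_banach_closed_point hepi_convex hepi_closed hnot
  let f₁ : E →L[ℝ] ℝ := f.comp (ContinuousLinearMap.inl ℝ E ℝ)
  let v : E := (InnerProductSpace.toDual ℝ E).symm f₁
  have hv : ∀ z, ⟪v, z⟫ = f₁ z := fun z => InnerProductSpace.toDual_symm_apply
  set β : ℝ := f (0, 1) with hβ
  have hsplit : ∀ z t, f (z, t) = ⟪v, z⟫ + t * β := by
    intro z t
    have : ((z, t) : E × ℝ) = (z, 0) + t • (0, 1) := by simp
    rw [this, map_add, map_smul, hv]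
    rfl
  obtain ⟨t₁, ht₁⟩ := hreal z₁ hz₁
  have hβ0 : β ≤ 0 := by
    by_contra hpos
    push Not at hpos
    -- otherwise `f` would be unbounded above on a vertical half-line of the epigraph
    obtain ⟨n, hn⟩ := exists_nat_gt ((u - ⟪v, z₁⟫ - t₁ * β) / β)
    have hmem : (z₁, t₁ + n) ∈ epi := by
      change g z₁ ≤ ((t₁ + n : ℝ) : EReal)
      rw [ht₁]
      exact EReal.coe_le_coe_iff.2 (by simp)
    have h1 := hfu _ hmem
    rw [hsplit] at h1
    rw [div_lt_iff₀ hpos] at hn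
    linarith
  rw [hsplit] at huf
  rcases hβ0.lt_or_eq with hneg | hzero
  · have hpos : 0 < -β := by linarith
    refine ⟨-u / (-β), (-β)⁻¹ • v, fun z => ?_, ?_⟩
    · by_cases hz : g z = ⊤
      · simp [hz]
      obtain ⟨t, ht⟩ := hreal z hz
      have h1 := hfu (z, t) (by change g z ≤ _; rw [ht])
      rw [hsplit] at h1
      rw [ht, EReal.coe_le_coe_iff, real_inner_smul_left, inv_mul_eq_div, ← add_div,
        div_le_iff₀ hpos]
      linarith
    · rw [real_inner_smul_left, inv_mul_eq_div, ← add_div, lt_div_iff₀ hpos]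
      linarith
  · -- a vertical hyperplane: add a large multiple of it to the constant lower bound
    rw [hzero, mul_zero, add_zero] at huf
    obtain ⟨n, hn⟩ := exists_nat_gt ((r - k) / (⟪v, z₀⟫ - u))
    rw [div_lt_iff₀ (by linarith)] at hn
    refine ⟨k - n * u, (n : ℝ) • v, fun z => ?_, ?_⟩
    · by_cases hz : g z = ⊤
      · simp [hz]
      obtain ⟨t, ht⟩ := hreal z hz
      have h1 := hfu (z, t) (by change g z ≤ _; rw [ht])
      rw [hsplit, hzero, mul_zero, add_zero] at h1
      refine le_trans ?_ (hk z)
      rw [EReal.coe_le_coe_iff, real_inner_smul_left]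
      nlinarith [mul_nonneg (Nat.cast_nonneg n : (0 : ℝ) ≤ n) (sub_nonneg.2 h1.le)]
    · rw [real_inner_smul_left]
      linarith

variable {Ω E : Type*} [PseudoMetricSpace Ω] [NormedAddCommGroup E] [InnerProductSpace ℝ E]

/-- Integrands on `S × E` that are jointly lower semicontinuous, convex in the second variable and
of uniformly superlinear growth: every slope `κ` is eventually exceeded, uniformly in `ω ∈ S`. -/
structure SuperlinearIntegrand (S : Set Ω) (C : Ω → E → EReal) : Prop where
  lsc : LowerSemicontinuousOn (fun p : Ω × E => C p.1 p.2) (S ×ˢ univ)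
  convex : ∀ ω ∈ S, ERealConvexOn univ (C ω)
  growth : ∀ κ : ℝ, ∃ b : ℝ, ∀ ω ∈ S, ∀ z, ((b + κ * ‖z‖ : ℝ) : EReal) ≤ C ω z

/-- The value at `(ω, z)` of the family of affine functions `z ↦ φ(ω) + ⟨ψ(ω), z⟩`. -/
def affineEval (p : (Ω →ᵇ ℝ) × (Ω →ᵇ E)) (ω : Ω) (z : E) : ℝ := p.1 ω + ⟪p.2 ω, z⟫

/-- The pairs `(φ, ψ)` of bounded continuous functions for which `z ↦ φ(ω) + ⟨ψ(ω), z⟩` lies below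
`C ω` for every `ω ∈ S`. -/
def minorants (S : Set Ω) (C : Ω → E → EReal) : Set ((Ω →ᵇ ℝ) × (Ω →ᵇ E)) :=
  {p | ∀ ω ∈ S, ∀ z, (affineEval p ω z : EReal) ≤ C ω z}

theorem continuous_affineEval (p : (Ω →ᵇ ℝ) × (Ω →ᵇ E)) :
    Continuous fun q : Ω × E => affineEval p q.1 q.2 := by
  unfold affineEval
  fun_prop

/-- The combination `η p + (1 - η) p'` of two families of affine functions. -/
def glue (η : Ω →ᵇ ℝ) (p p' : (Ω →ᵇ ℝ) × (Ω →ᵇ E)) : (Ω →ᵇ ℝ) × (Ω →ᵇ E) :=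
  (p'.1 + η * (p.1 - p'.1), p'.2 + η • (p.2 - p'.2))

theorem affineEval_glue (η : Ω →ᵇ ℝ) (p p' : (Ω →ᵇ ℝ) × (Ω →ᵇ E)) (ω : Ω) (z : E) :
    affineEval (glue η p p') ω z =
      affineEval p' ω z + η ω * (affineEval p ω z - affineEval p' ω z) := by
  have h : (η • (p.2 - p'.2)) ω = η ω • (p.2 ω - p'.2 ω) := rfl
  simp only [affineEval, glue, BoundedContinuousFunction.coe_add, BoundedContinuousFunction.coe_mul,
    BoundedContinuousFunction.coe_sub, Pi.add_apply, Pi.mul_apply, Pi.sub_apply,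
    h, inner_add_left, real_inner_smul_left, inner_sub_left]
  ring

theorem glue_mem_minorants {S : Set Ω} {C : Ω → E → EReal} {η : Ω →ᵇ ℝ}
    (h0 : ∀ ω, 0 ≤ η ω) (h1 : ∀ ω, η ω ≤ 1) {p p' : (Ω →ᵇ ℝ) × (Ω →ᵇ E)}
    (hp : p ∈ minorants S C) (hp' : p' ∈ minorants S C) : glue η p p' ∈ minorants S C := by
  intro ω hω z
  have h2 : affineEval (glue η p p') ω z ≤ max (affineEval p ω z) (affineEval p' ω z) := by
    rw [affineEval_glue]
    rcases le_total (affineEval p ω z) (affineEval p' ω z) with h | h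
    · rw [max_eq_right h]
      nlinarith [h0 ω]
    · rw [max_eq_left h]
      nlinarith [h1 ω]
  refine (EReal.coe_le_coe_iff.2 h2).trans ?_
  rcases max_choice (affineEval p ω z) (affineEval p' ω z) with h | h <;> rw [h]
  exacts [hp ω hω z, hp' ω hω z]

theorem const_mem_minorants {S : Set Ω} {C : Ω → E → EReal} {a : ℝ} {v : E}
    (h : ∀ ω ∈ S, ∀ z, ((a + ⟪v, z⟫ : ℝ) : EReal) ≤ C ω z) :
    (BoundedContinuousFunction.const Ω a, BoundedContinuousFunction.const Ω v) ∈ minorants S C :=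
  fun ω hω z => h ω hω z

theorem SuperlinearIntegrand.exists_le {S : Set Ω} {C : Ω → E → EReal}
    (hC : SuperlinearIntegrand S C) (v : E) :
    ∃ b : ℝ, ∀ ω ∈ S, ∀ z, ((b + ⟪v, z⟫ : ℝ) : EReal) ≤ C ω z := by
  obtain ⟨b, hb⟩ := hC.growth ‖v‖
  refine ⟨b, fun ω hω z => (EReal.coe_le_coe_iff.2 ?_).trans (hb ω hω z)⟩
  linarith [real_inner_le_norm v z]

/-- By superlinearity a strict affine minorant of `C ω₀` remains, after an arbitrarily small
decrease, a minorant of `C ω` for all `ω` near `ω₀`. -/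
theorem SuperlinearIntegrand.eventually_affine_le [ProperSpace E] {S : Set Ω} {C : Ω → E → EReal}
    (hC : SuperlinearIntegrand S C) {ω₀ : Ω} (hω₀ : ω₀ ∈ S) {a a' : ℝ} {v : E}
    (h : ∀ z, ((a + ⟪v, z⟫ : ℝ) : EReal) ≤ C ω₀ z) (ha : a' < a) :
    ∀ᶠ ω in 𝓝 ω₀, ω ∈ S → ∀ z, ((a' + ⟪v, z⟫ : ℝ) : EReal) ≤ C ω z := by
  obtain ⟨b, hb⟩ := hC.growth (‖v‖ + 1)
  have hK : IsCompact (Metric.closedBall (0 : E) (a' - b)) := isCompact_closedBall _ _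
  have hev : ∀ z ∈ Metric.closedBall (0 : E) (a' - b), ∀ᶠ q : Ω × E in 𝓝 (ω₀, z),
      (q.1 ∈ S → ((a' + ⟪v, q.2⟫ : ℝ) : EReal) ≤ C q.1 q.2) := by
    intro z _
    have h1 : (((a + a') / 2 + ⟪v, z⟫ : ℝ) : EReal) < C ω₀ z :=
      (EReal.coe_lt_coe_iff.2 (by linarith)).trans_le (h z)
    have h2 := hC.lsc (ω₀, z) ⟨hω₀, mem_univ _⟩ _ h1
    rw [eventually_nhdsWithin_iff] at h2
    have hcont : Continuous fun q : Ω × E => a' + ⟪v, q.2⟫ := by fun_prop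
    have h3 := (hcont.tendsto (ω₀, z)).eventually_lt_const
      (show a' + ⟪v, z⟫ < (a + a') / 2 + ⟪v, z⟫ by linarith)
    filter_upwards [h2, h3] with q hq hq' hqS
    exact (EReal.coe_le_coe_iff.2 hq'.le).trans (hq ⟨hqS, mem_univ _⟩).le
  have hball := hK.eventually_forall_of_forall_eventually
    (P := fun ω z => ω ∈ S → ((a' + ⟪v, z⟫ : ℝ) : EReal) ≤ C ω z) hev
  filter_upwards [hball] with ω hω hωS z
  by_cases hz : z ∈ Metric.closedBall (0 : E) (a' - b)
  · exact hω z hz hωS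
  · rw [mem_closedBall_zero_iff, not_le] at hz
    refine (EReal.coe_le_coe_iff.2 ?_).trans (hb ω hωS z)
    linarith [real_inner_le_norm v z]

/-- A superlinear integrand is the pointwise supremum of its minorants. -/
theorem SuperlinearIntegrand.exists_minorant_gt [ProperSpace E] {S : Set Ω}
    {C : Ω → E → EReal} (hC : SuperlinearIntegrand S C) {ω₀ : Ω} (hω₀ : ω₀ ∈ S) {z₀ : E} {r : ℝ}
    (hr : (r : EReal) < C ω₀ z₀) : ∃ p ∈ minorants S C, r < affineEval p ω₀ z₀ := by
  have hlsc : LowerSemicontinuous (C ω₀) := by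
    intro z y hy
    have h1 := hC.lsc (ω₀, z) ⟨hω₀, mem_univ _⟩ y hy
    rw [eventually_nhdsWithin_iff] at h1
    have hcont : Continuous fun w : E => (ω₀, w) := by fun_prop
    filter_upwards [hcont.continuousAt.eventually h1] with w hw
    exact hw ⟨hω₀, mem_univ _⟩
  obtain ⟨k, hk⟩ := hC.exists_le 0
  obtain ⟨a, v, hav, hrav⟩ := exists_affine_minorant (hC.convex ω₀ hω₀) hlsc
    (fun z => by simpa using hk ω₀ hω₀ z) hr
  obtain ⟨a', ha'r, ha'⟩ := exists_between (show r - ⟪v, z₀⟫ < a by linarith)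
  obtain ⟨b, hb⟩ := hC.exists_le v
  have hev := hC.eventually_affine_le hω₀ hav ha'
  obtain ⟨ρ, hρ, hball⟩ := Metric.eventually_nhds_iff_ball.1 hev
  obtain ⟨n, hn⟩ := exists_nat_one_div_lt hρ
  -- the minorant is `a' + ⟨v, z⟩` near `ω₀` and `b + ⟨v, z⟩` away from it
  refine ⟨glue (bump {ω₀} n) (BoundedContinuousFunction.const Ω a', .const Ω v)
    (BoundedContinuousFunction.const Ω (min a' b), .const Ω v), fun ω hω z => ?_, ?_⟩
  · rw [affineEval_glue]
    simp only [affineEval, BoundedContinuousFunction.const_apply]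
    by_cases hnear : ω ∈ Metric.ball ω₀ ρ
    · refine (EReal.coe_le_coe_iff.2 ?_).trans (hball ω hnear hω z)
      nlinarith [min_le_left a' b, bump_nonneg {ω₀} n ω, bump_le_one {ω₀} n ω]
    · have hzero : bump {ω₀} n ω = 0 := bump_eq_zero fun hmem => hnear <| by
        rw [Metric.thickening_singleton] at hmem
        exact Metric.ball_subset_ball hn.le hmem
      refine (EReal.coe_le_coe_iff.2 ?_).trans (hb ω hω z)
      rw [hzero]
      linarith [min_le_right a' b]
  · rw [affineEval_glue, bump_eq_one n (mem_singleton ω₀)]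
    simp only [affineEval, BoundedContinuousFunction.const_apply]
    linarith

/-- Countably many minorants suffice to recover a superlinear integrand. -/
theorem SuperlinearIntegrand.exists_seq_minorants [ProperSpace E]
    [SecondCountableTopology Ω] {S : Set Ω}
    {C : Ω → E → EReal} (hC : SuperlinearIntegrand S C) :
    ∃ p : ℕ → (Ω →ᵇ ℝ) × (Ω →ᵇ E), (∀ n, p n ∈ minorants S C) ∧
      ∀ ω ∈ S, ∀ z, C ω z = ⨆ n, (affineEval (p n) ω z : EReal) := by
  have hopen : ∀ (r : ℚ) (p : minorants S C),
      IsOpen {q : Ω × E | (r : ℝ) < affineEval p.1 q.1 q.2} := fun r p =>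
    isOpen_lt continuous_const (continuous_affineEval p.1)
  choose T hT hTU using fun r => TopologicalSpace.isOpen_iUnion_countable _ (hopen r)
  obtain ⟨k, hk⟩ := hC.exists_le 0
  let p₀ : minorants S C := ⟨_, const_mem_minorants hk⟩
  let T' : Set (minorants S C) := insert p₀ (⋃ r, T r)
  have hT'c : T'.Countable := (countable_iUnion hT).insert _
  obtain ⟨p, hp⟩ := hT'c.exists_eq_range ⟨p₀, mem_insert _ _⟩
  refine ⟨fun n => (p n).1, fun n => (p n).2, fun ω hω z => le_antisymm ?_ ?_⟩
  · refine le_of_forall_lt fun y hy => ?_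
    obtain ⟨r, hyr, hr⟩ := EReal.lt_iff_exists_rat_btwn.1 hy
    obtain ⟨q, hq, hrq⟩ := hC.exists_minorant_gt hω hr
    have hmem : (ω, z) ∈ ⋃ p : minorants S C, {q : Ω × E | (r : ℝ) < affineEval p.1 q.1 q.2} :=
      mem_iUnion.2 ⟨⟨q, hq⟩, hrq⟩
    rw [← hTU r] at hmem
    obtain ⟨q', hq', hlt⟩ := mem_iUnion₂.1 hmem
    have : q' ∈ range p := hp ▸ mem_insert_of_mem _ (mem_iUnion.2 ⟨r, hq'⟩)
    obtain ⟨n, rfl⟩ := this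
    refine hyr.trans_le (le_trans ?_ (le_iSup _ n))
    exact EReal.coe_le_coe_iff.2 (le_of_lt hlt)
  · exact iSup_le fun n => (p n).2 ω hω z

end Minorants

/-! ### Integrals of extended-real functions -/

section ErealIntegral

variable {Ω : Type*} [MeasurableSpace Ω]

theorem erealIntegral_congr_ae {m : Measure Ω} {f g : Ω → EReal} (h : f =ᵐ[m] g) :
    erealIntegral m f = erealIntegral m g := by
  unfold erealIntegral
  have h1 : ∫⁻ ω, (f ω).toENNReal ∂m = ∫⁻ ω, (g ω).toENNReal ∂m :=
    lintegral_congr_ae (h.fun_comp EReal.toENNReal)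
  have h2 : ∫⁻ ω, (-f ω).toENNReal ∂m = ∫⁻ ω, (-g ω).toENNReal ∂m :=
    lintegral_congr_ae (h.fun_comp fun y => (-y).toENNReal)
  rw [h1, h2]

/-- The identity `(y + K)⁺ + y⁻ = y⁺ + K` for `y ≥ -K`, which avoids subtraction of infinities. -/
theorem toENNReal_add_add_toENNReal_neg {y : EReal} {K : NNReal} (h : ((-K : ℝ) : EReal) ≤ y) :
    (y + ((K : ℝ) : EReal)).toENNReal + (-y).toENNReal = y.toENNReal + K := by
  induction y with
  | bot => exact absurd h (not_le.2 (EReal.bot_lt_coe _))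
  | top => simp
  | coe x =>
    have hx : -(K : ℝ) ≤ x := EReal.coe_le_coe_iff.1 h
    have e1 : ((x : EReal) + ((K : ℝ) : EReal)).toENNReal = ENNReal.ofReal (x + K) := by
      rw [← EReal.coe_add, EReal.toENNReal_of_ne_top (EReal.coe_ne_top _), EReal.toReal_coe]
    have e2 : (-(x : EReal)).toENNReal = ENNReal.ofReal (-x) := by
      rw [← EReal.coe_neg, EReal.toENNReal_of_ne_top (EReal.coe_ne_top _), EReal.toReal_coe]
    have e3 : (x : EReal).toENNReal = ENNReal.ofReal x := by
      rw [EReal.toENNReal_of_ne_top (EReal.coe_ne_top _), EReal.toReal_coe]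
    rw [e1, e2, e3, ← ENNReal.ofReal_coe_nnreal (p := K)]
    rcases le_total 0 x with h0 | h0
    · rw [ENNReal.ofReal_of_nonpos (p := -x) (by linarith), add_zero,
        ENNReal.ofReal_add h0 K.coe_nonneg]
    · rw [ENNReal.ofReal_of_nonpos (p := x) h0, zero_add,
        ← ENNReal.ofReal_add (by linarith) (by linarith)]
      congr 1
      ring

theorem coe_ennreal_sub_eq {A N D k : ℝ≥0∞} (hN : N ≠ ⊤) (hk : k ≠ ⊤) (h : D + N = A + k) :
    (A : EReal) - (N : EReal) = (D : EReal) - ((k.toReal : ℝ) : EReal) := by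
  lift k to NNReal using hk
  lift N to NNReal using hN
  rcases eq_or_ne A ⊤ with rfl | hA
  · have hD : D = ⊤ := by
      by_contra hD
      rw [top_add] at h
      exact (ENNReal.add_ne_top.2 ⟨hD, ENNReal.coe_ne_top⟩) h
    rw [hD]
    rfl
  · have hD : D ≠ ⊤ := by
      rintro rfl
      rw [top_add] at h
      exact (ENNReal.add_ne_top.2 ⟨hA, ENNReal.coe_ne_top⟩) h.symm
    lift A to NNReal using hA
    lift D to NNReal using hD
    have h2 : (D : ℝ) + N = A + k := by exact_mod_cast h
    have h3 : ∀ x : NNReal, (((x : ℝ≥0∞)) : EReal) = ((x : ℝ) : EReal) := fun x => rfl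
    rw [h3, h3, h3, ENNReal.coe_toReal, ← EReal.coe_sub, ← EReal.coe_sub]
    congr 1
    linarith

/-- For a function bounded below by `-K` the integral can be computed after adding `K`. -/
theorem erealIntegral_eq_lintegral_sub {m : Measure Ω} [IsFiniteMeasure m] {f : Ω → EReal}
    (hf : Measurable f) {K : NNReal} (hK : ∀ᵐ ω ∂m, ((-K : ℝ) : EReal) ≤ f ω) :
    erealIntegral m f =
      ((∫⁻ ω, (f ω + ((K : ℝ) : EReal)).toENNReal ∂m : ℝ≥0∞) : EReal) -
        ((K * m.real univ : ℝ) : EReal) := by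
  have hsum : ∫⁻ ω, (f ω + ((K : ℝ) : EReal)).toENNReal ∂m + ∫⁻ ω, (-f ω).toENNReal ∂m =
      ∫⁻ ω, (f ω).toENNReal ∂m + K * m univ := by
    have hneg : Measurable fun ω => (-f ω).toENNReal := hf.neg.ereal_toENNReal
    rw [← lintegral_add_right _ hneg, ← lintegral_const,
      ← lintegral_add_right _ measurable_const]
    refine lintegral_congr_ae ?_
    filter_upwards [hK] with ω hω using toENNReal_add_add_toENNReal_neg hω
  have hKm : (K : ℝ≥0∞) * m univ ≠ ⊤ := ENNReal.mul_ne_top (by simp) (measure_ne_top _ _)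
  have hNfin : ∫⁻ ω, (-f ω).toENNReal ∂m ≠ ⊤ := by
    refine ne_top_of_le_ne_top hKm ?_
    rw [← lintegral_const]
    refine lintegral_mono_ae ?_
    filter_upwards [hK] with ω hω
    have h1 : -f ω ≤ ((K : ℝ) : EReal) := by
      rw [EReal.neg_le, ← EReal.coe_neg]
      exact hω
    refine (EReal.toENNReal_le_toENNReal h1).trans ?_
    rw [EReal.toENNReal_of_ne_top (EReal.coe_ne_top _), EReal.toReal_coe,
      ENNReal.ofReal_coe_nnreal]
  have hKreal : (K * m.real univ : ℝ) = (K * m univ).toReal := by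
    simp [Measure.real, ENNReal.toReal_mul]
  rw [hKreal]
  exact coe_ennreal_sub_eq hNfin hKm hsum

end ErealIntegral

section ErealIntegralBounds

variable {Ω : Type*} [MeasurableSpace Ω]

theorem integral_le_erealIntegral {m : Measure Ω} [IsFiniteMeasure m] {f : Ω → EReal}
    (hf : Measurable f) {K : NNReal} (hK : ∀ᵐ ω ∂m, ((-K : ℝ) : EReal) ≤ f ω) {l : Ω → ℝ}
    (hl : Integrable l m) (hle : ∀ᵐ ω ∂m, (l ω : EReal) ≤ f ω) :
    ((∫ ω, l ω ∂m : ℝ) : EReal) ≤ erealIntegral m f := by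
  rw [erealIntegral_eq_lintegral_sub hf hK, EReal.le_sub_iff_add_le (Or.inl (EReal.coe_ne_bot _))
    (Or.inl (EReal.coe_ne_top _)),
    ← EReal.coe_add]
  have hint : ∫ ω, (l ω + K) ∂m = ∫ ω, l ω ∂m + K * m.real univ := by
    rw [integral_add hl (integrable_const _)]
    simp [mul_comm]
  rw [← hint]
  set D := ∫⁻ ω, (f ω + ((K : ℝ) : EReal)).toENNReal ∂m
  have hD : ∫⁻ ω, ENNReal.ofReal (l ω + K) ∂m ≤ D := by
    refine lintegral_mono_ae ?_
    filter_upwards [hle] with ω hω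
    have h1 := EReal.toENNReal_le_toENNReal (add_le_add_left hω ((K : ℝ) : EReal))
    rwa [← EReal.coe_add, EReal.toENNReal_of_ne_top (EReal.coe_ne_top _), EReal.toReal_coe] at h1
  rcases eq_or_ne D ⊤ with htop | htop
  · rw [htop]
    exact le_top
  · have h2 : ∫ ω, (l ω + K) ∂m ≤ D.toReal := by
      rw [integral_eq_lintegral_pos_part_sub_lintegral_neg_part
        (f := fun ω => l ω + K) (hl.add (integrable_const _))]
      have h3 := ENNReal.toReal_mono htop hD
      linarith [ENNReal.toReal_nonneg (a := ∫⁻ ω, ENNReal.ofReal (-(l ω + K)) ∂m)]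
    refine (EReal.coe_le_coe_iff.2 h2).trans_eq ?_
    exact EReal.coe_ennreal_toReal htop

/-- Monotone convergence: the integral of an increasing limit of real functions is bounded by a
bound for their integrals. -/
theorem erealIntegral_iSup_le {m : Measure Ω} [IsFiniteMeasure m] {u : ℕ → Ω → ℝ}
    (hu : ∀ n, Integrable (u n) m) (hum : ∀ n, Measurable (u n)) (hmono : Monotone u) {K : NNReal}
    (hK : ∀ n ω, -(K : ℝ) ≤ u n ω) {B : ℝ} (hB : ∀ n, ∫ ω, u n ω ∂m ≤ B) :
    erealIntegral m (fun ω => ⨆ n, (u n ω : EReal)) ≤ B := by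
  have hmeas : Measurable fun ω => ⨆ n, (u n ω : EReal) :=
    Measurable.iSup fun n => (hum n).coe_real_ereal
  have hK' : ∀ ω, ((-K : ℝ) : EReal) ≤ ⨆ n, (u n ω : EReal) := fun ω =>
    (EReal.coe_le_coe_iff.2 (hK 0 ω)).trans (le_iSup (fun n => (u n ω : EReal)) 0)
  rw [erealIntegral_eq_lintegral_sub hmeas (Eventually.of_forall hK')]
  have hpt : ∀ ω, ((⨆ n, (u n ω : EReal)) + ((K : ℝ) : EReal)).toENNReal =
      ⨆ n, ENNReal.ofReal (u n ω + K) := by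
    intro ω
    have h1 : Tendsto (fun n => (u n ω : EReal)) atTop (𝓝 (⨆ n, (u n ω : EReal))) :=
      tendsto_atTop_iSup fun a b hab => EReal.coe_le_coe_iff.2 (hmono hab ω)
    have h2 : Tendsto (fun n => ((u n ω : EReal) + ((K : ℝ) : EReal)).toENNReal) atTop
        (𝓝 ((⨆ n, (u n ω : EReal)) + ((K : ℝ) : EReal)).toENNReal) := by
      refine (EReal.continuous_toENNReal.tendsto _).comp ?_
      exact (EReal.continuousAt_add (Or.inr (EReal.coe_ne_bot _))
        (Or.inr (EReal.coe_ne_top _))).tendsto.comp (h1.prodMk_nhds tendsto_const_nhds)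
    have h3 : ∀ n, ((u n ω : EReal) + ((K : ℝ) : EReal)).toENNReal = ENNReal.ofReal (u n ω + K) :=
      fun n => by
        rw [← EReal.coe_add, EReal.toENNReal_of_ne_top (EReal.coe_ne_top _), EReal.toReal_coe]
    simp_rw [h3] at h2
    refine tendsto_nhds_unique h2 (tendsto_atTop_iSup fun a b hab => ?_)
    exact ENNReal.ofReal_le_ofReal (by linarith [hmono hab ω])
  have hint : ∀ n, ∫ ω, (u n ω + K) ∂m = ∫ ω, u n ω ∂m + K * m.real univ := fun n => by
    rw [integral_add (hu n) (integrable_const _)]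
    simp [mul_comm]
  have hle : ∫⁻ ω, ((⨆ n, (u n ω : EReal)) + ((K : ℝ) : EReal)).toENNReal ∂m ≤
      ENNReal.ofReal (B + K * m.real univ) := by
    simp_rw [hpt]
    rw [lintegral_iSup (fun n => ((hum n).add_const _).ennreal_ofReal)
      (fun a b hab ω => ENNReal.ofReal_le_ofReal (by linarith [hmono hab ω]))]
    refine iSup_le fun n => ?_
    rw [← ofReal_integral_eq_lintegral_ofReal (f := fun ω => u n ω + K)
      ((hu n).add (integrable_const _))
      (Eventually.of_forall fun ω => by change 0 ≤ u n ω + K; linarith [hK n ω])]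
    refine ENNReal.ofReal_le_ofReal ?_
    have h4 := hint n
    have h5 := hB n
    change ∫ ω, (u n ω + K) ∂m ≤ _
    linarith
  have hpos : 0 ≤ B + K * m.real univ := by
    have h6 : 0 ≤ ∫ ω, (u 0 ω + K) ∂m := integral_nonneg fun ω => by
      change 0 ≤ u 0 ω + K
      linarith [hK 0 ω]
    linarith [hint 0, hB 0]
  rw [EReal.sub_le_iff_le_add (Or.inl (EReal.coe_ne_bot _))
    (Or.inl (EReal.coe_ne_top _)), ← EReal.coe_add]
  refine (EReal.coe_ennreal_le_coe_ennreal_iff.2 hle).trans_eq ?_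
  rw [EReal.coe_ennreal_ofReal, max_eq_left hpos]

end ErealIntegralBounds

/-! ### Integrals of minorants -/

section Duality

variable {Ω E : Type*} [PseudoMetricSpace Ω] [MeasurableSpace Ω] [BorelSpace Ω]
  [NormedAddCommGroup E] [InnerProductSpace ℝ E]

/-- The duality pairing `∫ φ dγ + ∫ ⟨ψ, dq⟩`. -/
def pairing (p : (Ω →ᵇ ℝ) × (Ω →ᵇ E)) (γ : SignedMeasure Ω) (q : VectorMeasure Ω E) : ℝ :=
  γ.integral (fun ω => p.1 ω) (innerSL ℝ) + q.integral (fun ω => p.2 ω) (innerSL ℝ)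

theorem integrable_affineEval [SecondCountableTopology Ω] [SecondCountableTopology E]
    {m : Measure Ω} [IsFiniteMeasure m] {Z : Ω → E}
    (hZ : Integrable Z m) (p : (Ω →ᵇ ℝ) × (Ω →ᵇ E)) :
    Integrable (fun ω => affineEval p ω (Z ω)) m :=
  (p.1.integrable m).add (integrable_inner_of_bounded hZ p.2.continuous.stronglyMeasurable
    p.2.norm_coe_le_norm)

theorem pairing_toSignedMeasure_withDensityᵥ [SecondCountableTopology Ω]
    [SecondCountableTopology E] [CompleteSpace E] {m : Measure Ω} [IsFiniteMeasure m]
    {Z : Ω → E} (hZ : Integrable Z m) (p : (Ω →ᵇ ℝ) × (Ω →ᵇ E)) :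
    pairing p m.toSignedMeasure (m.withDensityᵥ Z) = ∫ ω, affineEval p ω (Z ω) ∂m := by
  unfold pairing affineEval
  rw [integral_toSignedMeasure_innerSL m p.1.continuous.stronglyMeasurable p.1.norm_coe_le_norm,
    integral_withDensityᵥ_inner hZ p.2.continuous.stronglyMeasurable p.2.norm_coe_le_norm,
    integral_add (p.1.integrable m) (integrable_inner_of_bounded hZ
      p.2.continuous.stronglyMeasurable p.2.norm_coe_le_norm)]

/-- The maximum of two minorants, evaluated along `Z`, is an `L¹`-limit of minorants: replace the
indicator of the set where the first one is larger by continuous functions. -/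
theorem exists_minorant_integral_max_sub_le [SecondCountableTopology Ω]
    [SecondCountableTopology E] {S : Set Ω} {C : Ω → E → EReal} {m : Measure Ω}
    [IsFiniteMeasure m] {Z : Ω → E} (hZ : Integrable Z m) (hZm : StronglyMeasurable Z)
    {p p' : (Ω →ᵇ ℝ) × (Ω →ᵇ E)}
    (hp : p ∈ minorants S C) (hp' : p' ∈ minorants S C) {ε : ℝ} (hε : 0 < ε) :
    ∃ p'' ∈ minorants S C,
      ∫ ω, |max (affineEval p ω (Z ω)) (affineEval p' ω (Z ω)) - affineEval p'' ω (Z ω)| ∂m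
        ≤ ε := by
  set w : Ω → ℝ := fun ω => affineEval p ω (Z ω) - affineEval p' ω (Z ω) with hw
  have hwi : Integrable w m := (integrable_affineEval hZ p).sub (integrable_affineEval hZ p')
  have hwm : StronglyMeasurable w := by
    have h1 : ∀ p : (Ω →ᵇ ℝ) × (Ω →ᵇ E), StronglyMeasurable fun ω => affineEval p ω (Z ω) :=
      fun p => p.1.continuous.stronglyMeasurable.add
        (p.2.continuous.stronglyMeasurable.inner hZm)
    exact (h1 p).sub (h1 p')
  let A : Set Ω := {ω | 0 ≤ w ω}
  have hA : MeasurableSet A := measurableSet_le measurable_const hwm.measurable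
  -- a closed subset `s` of `A` that exhausts `A` for the measure `|w| m`
  let κ : Measure Ω := m.withDensity fun ω => ‖w ω‖ₑ
  have hκ : IsFiniteMeasure κ := ⟨by simpa [κ] using! hwi.2⟩
  obtain ⟨s, hsA, hs, hlt⟩ := hA.exists_isClosed_sdiff_lt (μ := κ) (measure_ne_top _ _)
    (ENNReal.ofReal_pos.2 (half_pos hε)).ne'
  have hAs : MeasurableSet (A \ s) := hA.diff hs.measurableSet
  have hlt' : ∫ ω, (A \ s).indicator (fun ω => |w ω|) ω ∂m < ε / 2 := by
    have h1 : ENNReal.ofReal (∫ ω, (A \ s).indicator (fun ω => |w ω|) ω ∂m) = κ (A \ s) := by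
      rw [withDensity_apply _ hAs, integral_indicator hAs,
        ofReal_integral_eq_lintegral_ofReal hwi.abs.integrableOn
          (Eventually.of_forall fun ω => abs_nonneg _)]
      simp [Real.enorm_eq_ofReal_abs]
    rw [← h1] at hlt
    exact (ENNReal.ofReal_lt_ofReal_iff (half_pos hε)).1 hlt
  have hlim : Tendsto (fun k => ∫ ω, |s.indicator (fun _ => (1 : ℝ)) ω - bump s k ω| * |w ω| ∂m)
      atTop (𝓝 0) := by
    have h2 := tendsto_integral_of_dominated_convergence (μ := m) (f := fun _ => (0 : ℝ))
      (F := fun k ω => |s.indicator (fun _ => (1 : ℝ)) ω - bump s k ω| * |w ω|) (fun ω => |w ω|)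
      (fun k => ?_) hwi.abs (fun k => Eventually.of_forall fun ω => ?_)
      (Eventually.of_forall fun ω => ?_)
    · simpa using h2
    · have h3 : StronglyMeasurable (s.indicator fun _ : Ω => (1 : ℝ)) :=
        stronglyMeasurable_const.indicator hs.measurableSet
      exact ((h3.sub (bump s k).continuous.stronglyMeasurable).norm.mul
        hwm.norm).aestronglyMeasurable
    · rw [Real.norm_of_nonneg (by positivity)]
      exact mul_le_of_le_one_left (abs_nonneg _) (abs_indicator_sub_bump_le_one s k ω)
    · have h3 := ((tendsto_const_nhds (x := s.indicator (fun _ => (1 : ℝ)) ω)).sub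
        (tendsto_bump hs ω)).abs.mul_const |w ω|
      simpa using h3
  obtain ⟨k, hk⟩ := (hlim.eventually_lt_const (half_pos hε)).exists
  refine ⟨glue (bump s k) p p', glue_mem_minorants (bump_nonneg s k) (bump_le_one s k) hp hp', ?_⟩
  have hint1 : Integrable ((A \ s).indicator fun ω => |w ω|) m := hwi.abs.indicator hAs
  have hint2 : Integrable
      (fun ω => |s.indicator (fun _ => (1 : ℝ)) ω - bump s k ω| * |w ω|) m := by
    have h3 : StronglyMeasurable (s.indicator fun _ : Ω => (1 : ℝ)) :=
      stronglyMeasurable_const.indicator hs.measurableSet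
    refine Integrable.mono' (hwi.abs.const_mul 1) ((h3.sub
      (bump s k).continuous.stronglyMeasurable).norm.mul hwm.norm).aestronglyMeasurable
      (Eventually.of_forall fun ω => ?_)
    rw [Real.norm_of_nonneg (by positivity)]
    exact mul_le_mul_of_nonneg_right (abs_indicator_sub_bump_le_one s k ω) (abs_nonneg _)
  calc ∫ ω, |max (affineEval p ω (Z ω)) (affineEval p' ω (Z ω)) -
          affineEval (glue (bump s k) p p') ω (Z ω)| ∂m
      ≤ ∫ ω, ((A \ s).indicator (fun ω => |w ω|) ω +
          |s.indicator (fun _ => (1 : ℝ)) ω - bump s k ω| * |w ω|) ∂m := by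
        refine integral_mono_of_nonneg (Eventually.of_forall fun ω => abs_nonneg _)
          (hint1.add hint2) (Eventually.of_forall fun ω => ?_)
        simp only [affineEval_glue]
        have e1 : max (affineEval p ω (Z ω)) (affineEval p' ω (Z ω)) =
            affineEval p' ω (Z ω) + A.indicator (fun _ => (1 : ℝ)) ω * w ω := by
          by_cases hω : ω ∈ A
          · have h0 : 0 ≤ affineEval p ω (Z ω) - affineEval p' ω (Z ω) := hω
            rw [indicator_of_mem hω, max_eq_left (by linarith)]
            simp [hw]
          · have h0 : affineEval p ω (Z ω) - affineEval p' ω (Z ω) < 0 := not_le.1 hω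
            rw [indicator_of_notMem hω, max_eq_right (by linarith)]
            simp
        have e2 : A.indicator (fun _ => (1 : ℝ)) ω =
            (A \ s).indicator (fun _ => (1 : ℝ)) ω + s.indicator (fun _ => (1 : ℝ)) ω := by
          by_cases hωs : ω ∈ s
          · simp [hωs, hsA hωs]
          · by_cases hωA : ω ∈ A <;> simp [hωs, hωA]
        have e3 : (A \ s).indicator (fun ω => |w ω|) ω =
            |(A \ s).indicator (fun _ => (1 : ℝ)) ω * w ω| := by
          by_cases hω : ω ∈ A \ s <;> simp [hω]
        rw [e1, e2, e3, ← abs_mul]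
        refine le_trans (le_of_eq ?_) (abs_add_le _ _)
        congr 1
        simp only [hw]
        ring
    _ = _ := integral_add hint1 hint2
    _ ≤ ε := by linarith

/-- The partial maxima of a sequence of minorants, evaluated along `Z`, are `L¹`-limits of
minorants. -/
theorem exists_minorant_integral_partialSups_sub_le [SecondCountableTopology Ω]
    [SecondCountableTopology E] {S : Set Ω} {C : Ω → E → EReal} {m : Measure Ω}
    [IsFiniteMeasure m] {Z : Ω → E} (hZ : Integrable Z m) (hZm : StronglyMeasurable Z)
    {p : ℕ → (Ω →ᵇ ℝ) × (Ω →ᵇ E)} (hp : ∀ n, p n ∈ minorants S C) (N : ℕ) :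
    Integrable (fun ω => partialSups (fun n => affineEval (p n) ω (Z ω)) N) m ∧
    ∀ ε : ℝ, 0 < ε → ∃ p' ∈ minorants S C,
      ∫ ω, |partialSups (fun n => affineEval (p n) ω (Z ω)) N - affineEval p' ω (Z ω)| ∂m
        ≤ ε := by
  induction N with
  | zero =>
    simp only [partialSups_zero]
    exact ⟨integrable_affineEval hZ _, fun ε hε => ⟨p 0, hp 0, by simpa using hε.le⟩⟩
  | succ N ih =>
    obtain ⟨hint, happ⟩ := ih
    simp only [partialSups_add_one]
    refine ⟨hint.sup (integrable_affineEval hZ _), fun ε hε => ?_⟩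
    obtain ⟨p₁, hp₁, h1⟩ := happ (ε / 2) (half_pos hε)
    obtain ⟨p₂, hp₂, h2⟩ := exists_minorant_integral_max_sub_le hZ hZm hp₁ (hp (N + 1))
      (half_pos hε)
    have hi1 : Integrable (fun ω =>
        |partialSups (fun n => affineEval (p n) ω (Z ω)) N - affineEval p₁ ω (Z ω)|) m :=
      (hint.sub (integrable_affineEval hZ _)).abs
    have hi2 : Integrable (fun ω =>
        |max (affineEval p₁ ω (Z ω)) (affineEval (p (N + 1)) ω (Z ω)) -
          affineEval p₂ ω (Z ω)|) m :=
      (((integrable_affineEval hZ p₁).sup (integrable_affineEval hZ _)).sub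
        (integrable_affineEval hZ _)).abs
    refine ⟨p₂, hp₂, le_trans (integral_mono_of_nonneg
      (Eventually.of_forall fun ω => abs_nonneg _) (hi1.add hi2)
      (Eventually.of_forall fun ω => ?_)) ?_⟩
    · have h3 := abs_max_sub_max_le_abs (partialSups (fun n => affineEval (p n) ω (Z ω)) N)
        (affineEval p₁ ω (Z ω)) (affineEval (p (N + 1)) ω (Z ω))
      refine (abs_sub_le _ (max (affineEval p₁ ω (Z ω)) (affineEval (p (N + 1)) ω (Z ω))) _).trans
        ?_
      exact add_le_add_left h3 _
    · rw [integral_add' hi1 hi2]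
      linarith

end Duality

section Basic

variable {Ω E : Type*} [PseudoMetricSpace Ω] [NormedAddCommGroup E] [InnerProductSpace ℝ E]

theorem SuperlinearIntegrand.exists_nnreal_le {S : Set Ω} {C : Ω → E → EReal}
    (hC : SuperlinearIntegrand S C) :
    ∃ K : NNReal, ∀ ω ∈ S, ∀ z, ((-K : ℝ) : EReal) ≤ C ω z := by
  obtain ⟨k, hk⟩ := hC.exists_le 0
  refine ⟨(-k).toNNReal, fun ω hω z => le_trans (EReal.coe_le_coe_iff.2 ?_) (hk ω hω z)⟩
  have := Real.le_coe_toNNReal (-k)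
  simp only [inner_zero_left, add_zero]
  linarith

theorem measurable_affineEval [MeasurableSpace Ω] [BorelSpace Ω]
    [SecondCountableTopology E] {Z : Ω → E} (hZm : StronglyMeasurable Z)
    (p : (Ω →ᵇ ℝ) × (Ω →ᵇ E)) : Measurable fun ω => affineEval p ω (Z ω) :=
  (p.1.continuous.stronglyMeasurable.add (p.2.continuous.stronglyMeasurable.inner hZm)).measurable

end Basic

section Duality

variable {Ω E : Type*} [PseudoMetricSpace Ω] [MeasurableSpace Ω] [BorelSpace Ω]
  [SecondCountableTopology Ω] [NormedAddCommGroup E] [InnerProductSpace ℝ E] [ProperSpace E]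
  {S : Set Ω} {C : Ω → E → EReal}

theorem integral_affineEval_le_erealIntegral (hC : SuperlinearIntegrand S C)
    {m : Measure Ω} [IsFiniteMeasure m] (hS : m Sᶜ = 0) {Z : Ω → E} (hZ : Integrable Z m)
    (hZm : StronglyMeasurable Z) {p : (Ω →ᵇ ℝ) × (Ω →ᵇ E)} (hp : p ∈ minorants S C) :
    ((∫ ω, affineEval p ω (Z ω) ∂m : ℝ) : EReal) ≤ erealIntegral m fun ω => C ω (Z ω) := by
  obtain ⟨P, hP, hPC⟩ := hC.exists_seq_minorants
  obtain ⟨K, hK⟩ := hC.exists_nnreal_le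
  have hae : ∀ᵐ ω ∂m, ω ∈ S := hS
  have heq : (fun ω => C ω (Z ω)) =ᵐ[m] fun ω => ⨆ n, (affineEval (P n) ω (Z ω) : EReal) := by
    filter_upwards [hae] with ω hω using hPC ω hω _
  rw [erealIntegral_congr_ae heq]
  refine integral_le_erealIntegral (K := K)
    (Measurable.iSup fun n => (measurable_affineEval hZm _).coe_real_ereal) ?_
    (integrable_affineEval hZ p) ?_
  · filter_upwards [hae] with ω hω
    rw [← hPC ω hω]
    exact hK ω hω _
  · filter_upwards [hae] with ω hω
    rw [← hPC ω hω]
    exact hp ω hω _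

/-- The integral of a superlinear integrand along `Z` is at most the supremum of the integrals of
its minorants: it is the increasing limit of integrals of partial maxima, which minorants
approximate. -/
theorem erealIntegral_le_of_forall_minorants (hC : SuperlinearIntegrand S C)
    {m : Measure Ω} [IsFiniteMeasure m] (hS : m Sᶜ = 0) {Z : Ω → E} (hZ : Integrable Z m)
    (hZm : StronglyMeasurable Z) {B : ℝ}
    (hB : ∀ p ∈ minorants S C, ∫ ω, affineEval p ω (Z ω) ∂m ≤ B) :
    (erealIntegral m fun ω => C ω (Z ω)) ≤ B := by
  obtain ⟨P', hP', hPC'⟩ := hC.exists_seq_minorants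
  obtain ⟨K, hK⟩ := hC.exists_nnreal_le
  -- put a constant lower bound in front of the sequence, so that all partial maxima exceed it
  let P : ℕ → (Ω →ᵇ ℝ) × (Ω →ᵇ E) := fun n =>
    n.casesOn (BoundedContinuousFunction.const Ω (-(K : ℝ)), BoundedContinuousFunction.const Ω 0) P'
  have hP0 : ∀ ω z, affineEval (P 0) ω z = -(K : ℝ) := fun ω z => by
    simp [P, affineEval]
  have hP : ∀ n, P n ∈ minorants S C := by
    intro n
    cases n with
    | zero =>
      intro ω hω z
      rw [hP0]
      exact hK ω hω z
    | succ n => exact hP' n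
  set u : ℕ → Ω → ℝ := fun N ω => partialSups (fun n => affineEval (P n) ω (Z ω)) N with hu
  have hae : ∀ᵐ ω ∂m, ω ∈ S := hS
  have heq : (fun ω => C ω (Z ω)) =ᵐ[m] fun ω => ⨆ n, (u n ω : EReal) := by
    filter_upwards [hae] with ω hω
    refine le_antisymm ?_ (iSup_le fun n => ?_)
    · rw [hPC' ω hω]
      refine iSup_le fun n => le_iSup_of_le (n + 1) (EReal.coe_le_coe_iff.2 ?_)
      exact le_partialSups (fun n => affineEval (P n) ω (Z ω)) (n + 1)
    · obtain ⟨k, -, hk⟩ := exists_partialSups_eq (fun n => affineEval (P n) ω (Z ω)) n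
      simp only [hu, hk]
      exact hP k ω hω _
  rw [erealIntegral_congr_ae heq]
  have hum : ∀ n, Measurable (u n) := by
    intro n
    induction n with
    | zero =>
      simp only [hu, partialSups_zero]
      exact measurable_affineEval hZm _
    | succ n ih =>
      simp only [hu, partialSups_add_one]
      exact ih.sup (measurable_affineEval hZm _)
  refine erealIntegral_iSup_le (K := K)
    (fun n => (exists_minorant_integral_partialSups_sub_le hZ hZm hP n).1) hum
    (fun a b hab ω => (partialSups fun n => affineEval (P n) ω (Z ω)).monotone hab)
    (fun n ω => ?_) fun n => ?_
  · have := le_partialSups_of_le (fun n => affineEval (P n) ω (Z ω)) (Nat.zero_le n)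
    rwa [hP0] at this
  · refine le_of_forall_pos_le_add fun ε hε => ?_
    obtain ⟨hint, happ⟩ := exists_minorant_integral_partialSups_sub_le hZ hZm hP n
    obtain ⟨p, hp, hle⟩ := happ ε hε
    have h1 := integral_sub hint (integrable_affineEval hZ p)
    have h2 : ∫ ω, (u n ω - affineEval p ω (Z ω)) ∂m ≤
        ∫ ω, |u n ω - affineEval p ω (Z ω)| ∂m :=
      integral_mono (hint.sub (integrable_affineEval hZ p))
        (hint.sub (integrable_affineEval hZ p)).abs fun ω => le_abs_self _
    have h3 := hB p hp
    simp only [hu] at h2 ⊢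
    linarith

end Duality

/-! ### Pairs of measures with bounded pairings -/

/-- Affine functions with coefficients that are constant on the closed set `s` and constant off it
may be paired with `(γ, q)`, in the limit of continuous coefficients. -/
theorem tendsto_pairing_glue {Ω E : Type*} [PseudoMetricSpace Ω] [MeasurableSpace Ω]
    [BorelSpace Ω] [NormedAddCommGroup E] [InnerProductSpace ℝ E] [CompleteSpace E]
    (γ : SignedMeasure Ω) (q : VectorMeasure Ω E)
    [IsFiniteMeasure q.variation] {s : Set Ω} (hs : IsClosed s) (a k : ℝ) (v : E) :
    Tendsto (fun n => pairing (glue (bump s n) (BoundedContinuousFunction.const Ω a, .const Ω v)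
      (BoundedContinuousFunction.const Ω k, .const Ω 0)) γ q) atTop
      (𝓝 (k * γ univ + (a - k) * γ s + ⟪v, q s⟫)) := by
  have h1 := tendsto_integral_bump γ hs (a - k)
  have h2 := tendsto_integral_bump q hs v
  have e : ∀ n, pairing (glue (bump s n) (BoundedContinuousFunction.const Ω a, .const Ω v)
      (BoundedContinuousFunction.const Ω k, .const Ω 0)) γ q =
      k * γ univ + VectorMeasure.integral γ (fun ω => bump s n ω • (a - k)) (innerSL ℝ) +
        q.integral (fun ω => bump s n ω • v) (innerSL ℝ) := by
    intro n
    unfold pairing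
    have e1 : (fun ω => (glue (bump s n) (BoundedContinuousFunction.const Ω a,
        BoundedContinuousFunction.const Ω v) (BoundedContinuousFunction.const Ω k,
        BoundedContinuousFunction.const Ω 0)).1 ω) = fun ω => k + bump s n ω • (a - k) := rfl
    have e2 : (fun ω => (glue (bump s n) (BoundedContinuousFunction.const Ω a,
        BoundedContinuousFunction.const Ω v) (BoundedContinuousFunction.const Ω k,
        BoundedContinuousFunction.const Ω 0)).2 ω) = fun ω => bump s n ω • v := by
      funext ω
      change 0 + bump s n ω • (v - 0) = _
      simp
    rw [e1, e2, VectorMeasure.integral_fun_add (integrable_const _)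
      (((bump s n).integrable _).smul_const _), VectorMeasure.integral_const]
    simp [innerSL_apply_apply ℝ, mul_comm]
  simp_rw [e]
  have h3 := (tendsto_const_nhds (x := k * γ univ)).add h1 |>.add h2
  convert h3 using 2
  simp [mul_comm]

section PairingLimits

variable {Ω E : Type*} [PseudoMetricSpace Ω] [MeasurableSpace Ω] [BorelSpace Ω]
  [NormedAddCommGroup E] [InnerProductSpace ℝ E] [CompleteSpace E]
  {S : Set Ω} {C : Ω → E → EReal}

/-- A bound on the pairings with all minorants extends to the affine functions equal to `a + ⟨v, z⟩`
on a closed set `s` and to the constant `k` off it. -/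
theorem le_of_forall_pairing_le {γ : SignedMeasure Ω} {q : VectorMeasure Ω E}
    [IsFiniteMeasure q.variation] {B : ℝ} (hB : ∀ p ∈ minorants S C, pairing p γ q ≤ B)
    {a k : ℝ} {v : E} (hk : ∀ ω ∈ S, ∀ z, (k : EReal) ≤ C ω z)
    (ha : ∀ ω ∈ S, ∀ z, ((a + ⟪v, z⟫ : ℝ) : EReal) ≤ C ω z) {s : Set Ω} (hs : IsClosed s) :
    k * γ univ + (a - k) * γ s + ⟪v, q s⟫ ≤ B := by
  refine le_of_tendsto' (tendsto_pairing_glue γ q hs a k v) fun n => hB _ ?_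
  exact glue_mem_minorants (bump_nonneg s n) (bump_le_one s n) (const_mem_minorants ha)
    (const_mem_minorants fun ω hω z => by simpa using hk ω hω z)

/-- Finiteness of the supremum over the minorants forces `γ ≥ 0`: a minorant may take arbitrarily
negative values on a set of negative `γ`-mass. -/
theorem nonneg_of_forall_pairing_le (hC : SuperlinearIntegrand S C) {γ : SignedMeasure Ω}
    {q : VectorMeasure Ω E} [IsFiniteMeasure q.variation] {B : ℝ}
    (hB : ∀ p ∈ minorants S C, pairing p γ q ≤ B) : 0 ≤ γ := by
  obtain ⟨k, hk⟩ := hC.exists_le 0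
  simp only [inner_zero_left, add_zero] at hk
  rw [VectorMeasure.le_iff]
  intro A hA
  by_contra hneg
  rw [FunLike.coe_zero, Pi.zero_apply, not_le] at hneg
  obtain ⟨s, -, hs, hlt⟩ := exists_isClosed_norm_sub_lt γ hA (neg_pos.2 hneg)
  have hγs : γ s < 0 := by
    have := (abs_lt.1 (show |γ A - γ s| < -γ A from hlt)).1
    linarith
  obtain ⟨n, hn⟩ := exists_nat_gt ((B - k * γ univ) / (-γ s))
  rw [div_lt_iff₀ (by linarith)] at hn
  have h1 := le_of_forall_pairing_le (a := k - n) (v := 0) hB hk (fun ω hω z => by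
    refine le_trans (EReal.coe_le_coe_iff.2 ?_) (hk ω hω z)
    simp) hs
  simp only [inner_zero_left, add_zero] at h1
  linarith

/-- Finiteness of the supremum over the minorants forces `q ≪ γ`: the slopes of the minorants are
unbounded, so `q` cannot charge a set that `γ` does not. -/
theorem absolutelyContinuous_of_forall_pairing_le (hC : SuperlinearIntegrand S C)
    {γ : SignedMeasure Ω} {q : VectorMeasure Ω E} [IsFiniteMeasure q.variation] {B : ℝ}
    (hB : ∀ p ∈ minorants S C, pairing p γ q ≤ B) : q ≪ᵥ γ := by
  have hγ := nonneg_of_forall_pairing_le hC hB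
  obtain ⟨k, hk⟩ := hC.exists_le 0
  simp only [inner_zero_left, add_zero] at hk
  refine VectorMeasure.AbsolutelyContinuous.mk fun A hA hγA => ?_
  by_contra hne
  obtain ⟨s, hsA, hs, hlt⟩ := exists_isClosed_norm_sub_lt q hA (norm_pos_iff.2 hne)
  have hqs : q s ≠ 0 := by
    intro h0
    simp [h0] at hlt
  have hγs : γ s = 0 := by
    have h1 : 0 ≤ γ s := (VectorMeasure.le_iff.1 hγ) s hs.measurableSet
    have h2 : 0 ≤ γ (A \ s) := (VectorMeasure.le_iff.1 hγ) _ (hA.diff hs.measurableSet)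
    have h3 := VectorMeasure.of_add_of_sdiff (v := γ) hs.measurableSet hA hsA
    linarith
  have hpos : 0 < ⟪q s, q s⟫ := real_inner_self_pos.2 hqs
  obtain ⟨n, hn⟩ := exists_nat_gt ((B - k * γ univ) / ⟪q s, q s⟫)
  rw [div_lt_iff₀ hpos] at hn
  -- slope `n • q s` on `s`: its intercept `a` is harmless since `γ s = 0`
  obtain ⟨a, ha⟩ := hC.exists_le ((n : ℝ) • q s)
  have h1 := le_of_forall_pairing_le hB hk ha hs
  rw [hγs, real_inner_smul_left] at h1
  linarith

end PairingLimits

/-! ### The functional as a supremum of continuous linear functionals -/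

section Functional

variable {d : ℕ} {μ ν : ProbabilityMeasure (Euc d)} {c : Euc d → Euc d → Euc d → EReal}

theorem isClosed_suppProd (μ ν : ProbabilityMeasure (Euc d)) : IsClosed (suppProd μ ν) :=
  Measure.isClosed_support.prod Measure.isClosed_support

/-- The standing conditions on the cost give a superlinear integrand on `X × Y`. -/
theorem CostConditions.superlinearIntegrand
    (hc : CostConditions (μ : Measure (Euc d)).support (ν : Measure (Euc d)).support c) :
    SuperlinearIntegrand (suppProd μ ν) (fun ω z => c ω.1 ω.2 z) where
  lsc := by
    have hcont : Continuous fun p : (Euc d × Euc d) × Euc d => (p.1.1, p.1.2, p.2) := by fun_prop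
    exact hc.lsc.comp hcont.continuousOn fun p hp => ⟨hp.1.1, hp.1.2, hp.2⟩
  convex := fun ω hω => hc.convex ω.1 hω.1 ω.2 hω.2
  growth := by
    intro κ
    obtain ⟨k, hk⟩ := hc.bounded_below
    obtain ⟨h, -, hlim, hle⟩ := hc.superlinear
    have hev := hlim.eventually_ge_atTop (max κ 0)
    rw [Filter.hasBasis_cobounded_norm.eventually_iff] at hev
    obtain ⟨R, -, hR⟩ := hev
    refine ⟨min 0 (k - |κ| * |R|), fun ω hω z => ?_⟩
    by_cases hz : R ≤ ‖z‖ ∧ 0 < ‖z‖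
    · refine (EReal.coe_le_coe_iff.2 ?_).trans (hle ω.1 hω.1 ω.2 hω.2 z)
      have h1 := hR hz.1
      rw [le_div_iff₀ hz.2] at h1
      have h2 : κ * ‖z‖ ≤ max κ 0 * ‖z‖ :=
        mul_le_mul_of_nonneg_right (le_max_left _ _) (norm_nonneg z)
      linarith [min_le_left 0 (k - |κ| * |R|)]
    · refine (EReal.coe_le_coe_iff.2 ?_).trans (hk ω.1 hω.1 ω.2 hω.2 z)
      have hzR : ‖z‖ ≤ |R| := by
        by_cases h0 : R ≤ ‖z‖
        · have : ‖z‖ ≤ 0 := not_lt.1 fun h => hz ⟨h0, h⟩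
          exact this.trans (abs_nonneg R)
        · exact (not_le.1 h0).le.trans (le_abs_self R)
      have h1 : κ * ‖z‖ ≤ |κ| * |R| :=
        (mul_le_mul_of_nonneg_right (le_abs_self κ) (norm_nonneg z)).trans
          (mul_le_mul_of_nonneg_left hzR (abs_nonneg κ))
      linarith [min_le_right 0 (k - |κ| * |R|)]

/-- The minorants of the cost of the transport problem. -/
abbrev costMinorants (μ ν : ProbabilityMeasure (Euc d)) (c : Euc d → Euc d → Euc d → EReal) :
    Set (((Euc d × Euc d) →ᵇ ℝ) × ((Euc d × Euc d) →ᵇ Euc d)) :=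
  minorants (suppProd μ ν) fun ω z => c ω.1 ω.2 z

/-- A pair with `γ ≥ 0` and `q ≪ γ` in terms of the positive measure `|γ| = γ` and the density of
`q`. -/
theorem variation_and_density {p : Pairs d} (h0 : 0 ≤ p.1) (hac : p.2 ≪ᵥ p.1) :
    p.1.variation.toSignedMeasure = p.1 ∧
      Integrable (vecRnDeriv p.2 p.1.variation) p.1.variation ∧
      p.1.variation.withDensityᵥ (vecRnDeriv p.2 p.1.variation) = p.2 := by
  obtain ⟨_, h1⟩ := variation_of_nonneg p.1 h0
  refine ⟨h1, withDensity_vecRnDeriv p.2 p.1.variation ?_⟩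
  refine VectorMeasure.AbsolutelyContinuous.mk fun A hA hzero => hac ?_
  rw [Measure.toENNRealVectorMeasure_apply_measurable hA] at hzero
  rw [← h1, Measure.toSignedMeasure_apply_measurable hA, Measure.real, hzero, ENNReal.toReal_zero]

theorem measurable_vecRnDeriv {Ω : Type*} [MeasurableSpace Ω] (q : VectorMeasure Ω (Euc d))
    (m : Measure Ω) : Measurable (vecRnDeriv q m) := by
  refine (WithLp.measurable_toLp 2 _).comp (measurable_pi_lambda _ fun i => ?_)
  exact SignedMeasure.measurable_rnDeriv _ _

theorem pairing_eq_integral {p : Pairs d} (h0 : 0 ≤ p.1) (hac : p.2 ≪ᵥ p.1)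
    (P : ((Euc d × Euc d) →ᵇ ℝ) × ((Euc d × Euc d) →ᵇ Euc d)) :
    pairing P p.1 p.2 =
      ∫ ω, affineEval P ω (vecRnDeriv p.2 p.1.variation ω) ∂p.1.variation := by
  obtain ⟨h1, hint, h2⟩ := variation_and_density h0 hac
  rw [← pairing_toSignedMeasure_withDensityᵥ hint, h1, h2]

theorem pairing_le_functional
    (hc : CostConditions (μ : Measure (Euc d)).support (ν : Measure (Euc d)).support c)
    {p : Pairs d} (hp : p ∈ pairsOn μ ν)
    {P : ((Euc d × Euc d) →ᵇ ℝ) × ((Euc d × Euc d) →ᵇ Euc d)} (hP : P ∈ costMinorants μ ν c) :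
    ((pairing P p.1 p.2 : ℝ) : EReal) ≤ functional c p := by
  unfold functional
  split_ifs with h
  · rw [pairing_eq_integral h.1 h.2]
    exact integral_affineEval_le_erealIntegral hc.superlinearIntegrand hp.1
      (variation_and_density h.1 h.2).2.1 (measurable_vecRnDeriv _ _).stronglyMeasurable hP
  · exact le_top

/-- A real bound for all pairings bounds the functional. In particular such a bound rules out the
value `+∞` given to pairs that violate `γ ≥ 0` or `q ≪ γ`. -/
theorem functional_le_of_forall_pairing_le
    (hc : CostConditions (μ : Measure (Euc d)).support (ν : Measure (Euc d)).support c)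
    {p : Pairs d} (hp : p ∈ pairsOn μ ν) {B : ℝ}
    (hB : ∀ P ∈ costMinorants μ ν c, pairing P p.1 p.2 ≤ B) : functional c p ≤ B := by
  have h0 := nonneg_of_forall_pairing_le hc.superlinearIntegrand hB
  have hac := absolutelyContinuous_of_forall_pairing_le hc.superlinearIntegrand hB
  unfold functional
  rw [if_pos ⟨h0, hac⟩]
  refine erealIntegral_le_of_forall_minorants hc.superlinearIntegrand hp.1
    (variation_and_density h0 hac).2.1 (measurable_vecRnDeriv _ _).stronglyMeasurable
    fun P hP => ?_
  rw [← pairing_eq_integral h0 hac]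
  exact hB P hP

/-- Duality: on the pairs of measures carried by `X × Y` the functional is the supremum of the
weakly continuous linear functionals given by the minorants of the cost. -/
theorem functional_eq_iSup
    (hc : CostConditions (μ : Measure (Euc d)).support (ν : Measure (Euc d)).support c)
    {p : Pairs d} (hp : p ∈ pairsOn μ ν) :
    functional c p = ⨆ P : costMinorants μ ν c, ((pairing P.1 p.1 p.2 : ℝ) : EReal) := by
  refine le_antisymm ?_ (iSup_le fun P => pairing_le_functional hc hp P.2)
  refine EReal.le_of_forall_lt_iff_le.1 fun B hB => ?_
  refine functional_le_of_forall_pairing_le hc hp fun P hP => ?_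
  exact EReal.coe_le_coe_iff.1
    ((le_iSup (fun P : costMinorants μ ν c => ((pairing P.1 p.1 p.2 : ℝ) : EReal)) ⟨P, hP⟩).trans
      hB.le)

theorem continuous_pairing (P : ((Euc d × Euc d) →ᵇ ℝ) × ((Euc d × Euc d) →ᵇ Euc d)) :
    Continuous fun p : Pairs d => pairing P p.1 p.2 :=
  ((continuous_integral_boundedContinuous P.1).comp continuous_fst).add
    ((continuous_integral_boundedContinuous P.2).comp continuous_snd)

theorem pairing_combination (P : ((Euc d × Euc d) →ᵇ ℝ) × ((Euc d × Euc d) →ᵇ Euc d))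
    (p p' : Pairs d) (a b : ℝ) :
    pairing P (a • p + b • p').1 (a • p + b • p').2 =
      a * pairing P p.1 p.2 + b * pairing P p'.1 p'.2 := by
  have h : ∀ {F : Type} [NormedAddCommGroup F] [InnerProductSpace ℝ F] [MeasurableSpace F]
      [BorelSpace F] [SecondCountableTopology F]
      (σ τ : VectorMeasure (Euc d × Euc d) F) [IsFiniteMeasure σ.variation]
      [IsFiniteMeasure τ.variation] (Φ : (Euc d × Euc d) →ᵇ F),
      (a • σ + b • τ).integral (fun ω => Φ ω) (innerSL ℝ) =
        a * σ.integral (fun ω => Φ ω) (innerSL ℝ) + b * τ.integral (fun ω => Φ ω) (innerSL ℝ) := by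
    intro F _ _ _ _ _ σ τ _ _ Φ
    have h1 : σ.Integrable Φ := Φ.integrable _
    have h2 : τ.Integrable Φ := Φ.integrable _
    rw [VectorMeasure.integral_add_vectorMeasure (h1.smul_vectorMeasure a)
      (h2.smul_vectorMeasure b), VectorMeasure.integral_smul_vectorMeasure,
      VectorMeasure.integral_smul_vectorMeasure]
    rfl
  unfold pairing
  have e1 := h p.1 p'.1 P.1
  have e2 := h p.2 p'.2 P.2
  change VectorMeasure.integral (a • p.1 + b • p'.1) _ _ +
    VectorMeasure.integral (a • p.2 + b • p'.2) _ _ = _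
  rw [e1, e2]
  ring

theorem convexOn_functional
    (hc : CostConditions (μ : Measure (Euc d)).support (ν : Measure (Euc d)).support c) :
    ERealConvexOn (pairsOn μ ν) (functional c) := by
  have hS : MeasurableSet (suppProd μ ν) := (isClosed_suppProd μ ν).measurableSet
  have hconv : Convex ℝ (pairsOn μ ν) := (convex_carriedBy hS).prod (convex_carriedBy hS)
  refine ⟨hconv, fun p hp p' hp' a b ha hb hab => ?_⟩
  rw [functional_eq_iSup hc (hconv hp hp' ha.le hb.le hab)]
  refine iSup_le fun P => ?_
  rw [pairing_combination, EReal.coe_add, EReal.coe_mul, EReal.coe_mul]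
  exact add_le_add
    (mul_le_mul_of_nonneg_left (pairing_le_functional hc hp P.2) (EReal.coe_nonneg.2 ha.le))
    (mul_le_mul_of_nonneg_left (pairing_le_functional hc hp' P.2) (EReal.coe_nonneg.2 hb.le))

theorem lowerSemicontinuousOn_functional
    (hc : CostConditions (μ : Measure (Euc d)).support (ν : Measure (Euc d)).support c) :
    LowerSemicontinuousOn (functional c) (pairsOn μ ν) := by
  have h : LowerSemicontinuousOn
      (fun p : Pairs d => ⨆ P : costMinorants μ ν c, ((pairing P.1 p.1 p.2 : ℝ) : EReal))
      (pairsOn μ ν) :=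
    (lowerSemicontinuous_iSup fun P : costMinorants μ ν c =>
      (continuous_coe_real_ereal.comp (continuous_pairing P.1)).lowerSemicontinuous
      ).lowerSemicontinuousOn _
  intro p hp y hy
  rw [functional_eq_iSup hc hp] at hy
  filter_upwards [h p hp y hy, self_mem_nhdsWithin] with p' h1 h2
  rwa [functional_eq_iSup hc h2]

theorem functional_eq_cost {p : Pairs d} (hp : p ∈ GamQ μ ν) : functional c p = cost c p :=
  if_pos ⟨hp.1.2.1, hp.2.2⟩

theorem GamQ_subset_pairsOn : GamQ μ ν ⊆ pairsOn μ ν := fun _ hp => ⟨hp.1.1, hp.2.1.1⟩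

end Functional

/-! ### Compactness through probability measures on `X × Y × ℝ^d` -/

section YoungMeasures

/-- Bounds on the integral of a nonnegative continuous function, possibly unbounded, are weakly
closed: such an integral is the supremum of the integrals of truncations. -/
theorem isClosed_setOf_lintegral_le {X : Type*} [MeasurableSpace X] [TopologicalSpace X]
    [OpensMeasurableSpace X] {g : X → NNReal} (hg : Continuous g) (A : NNReal) :
    IsClosed {π : ProbabilityMeasure X | ∫⁻ x, g x ∂(π : Measure X) ≤ A} := by
  let f : ℕ → X →ᵇ NNReal := fun k =>
    ⟨⟨fun x => min (g x) k, by fun_prop⟩, k, fun x y => by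
      have h0 : (min (g x) k : NNReal) ≤ k := min_le_right _ _
      have h1 : (min (g y) k : NNReal) ≤ k := min_le_right _ _
      rw [NNReal.dist_eq, abs_le]
      have h2 : ((min (g x) k : NNReal) : ℝ) ≤ k := by exact_mod_cast h0
      have h3 : ((min (g y) k : NNReal) : ℝ) ≤ k := by exact_mod_cast h1
      have h4 := (min (g x) (k : NNReal)).coe_nonneg
      have h5 := (min (g y) (k : NNReal)).coe_nonneg
      constructor <;> linarith⟩
  have hf : ∀ k x, f k x = min (g x) k := fun k x => rfl
  have hset : {π : ProbabilityMeasure X | ∫⁻ x, g x ∂(π : Measure X) ≤ A} =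
      ⋂ k, {π : ProbabilityMeasure X | π.toFiniteMeasure.testAgainstNN (f k) ≤ A} := by
    ext π
    simp only [mem_ofPred_eq, mem_iInter, ← ENNReal.coe_le_coe, FiniteMeasure.testAgainstNN_coe_eq]
    constructor
    · intro h k
      refine (lintegral_mono fun x => ?_).trans h
      exact ENNReal.coe_le_coe.2 (min_le_left _ _)
    · intro h
      have hsup : ∀ x, (g x : ℝ≥0∞) = ⨆ k, (f k x : ℝ≥0∞) := by
        intro x
        refine le_antisymm ?_ (iSup_le fun k => ENNReal.coe_le_coe.2 (min_le_left _ _))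
        obtain ⟨k, hk⟩ := exists_nat_ge (g x)
        refine le_iSup_of_le k ?_
        rw [hf, min_eq_left hk]
      simp_rw [hsup]
      rw [lintegral_iSup (fun k => (f k).continuous.measurable.coe_nnreal_ennreal)
        (fun a b hab x => ENNReal.coe_le_coe.2 (by
          rw [hf, hf]
          exact min_le_min_left _ (by exact_mod_cast hab)))]
      exact iSup_le h
  rw [hset]
  exact isClosed_iInter fun k =>
    isClosed_le (ProbabilityMeasure.continuous_testAgainstNN_eval (f k)) continuous_const

theorem isTightMeasureSet_of_lintegral_norm_le {E : Type*} [NormedAddCommGroup E] [ProperSpace E]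
    [MeasurableSpace E] [BorelSpace E] {T : Set (Measure E)} {b : ℝ} {A : NNReal}
    (hT : ∀ m ∈ T, ∫⁻ z, (b + ‖z‖).toNNReal ∂m ≤ A) : IsTightMeasureSet T := by
  rw [isTightMeasureSet_iff_exists_isCompact_measure_compl_le]
  intro ε hε
  rcases eq_or_ne ε ⊤ with rfl | htop
  · exact ⟨∅, isCompact_empty, fun _ _ => le_top⟩
  lift ε to NNReal using htop
  have hε' : 0 < (ε : ℝ) := by exact_mod_cast hε
  refine ⟨Metric.closedBall 0 (A / ε + 1 - b), isCompact_closedBall _ _, fun m hm => ?_⟩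
  have hsub : (Metric.closedBall (0 : E) (A / ε + 1 - b))ᶜ ⊆
      {z | ((A / ε + 1 : NNReal) : ℝ≥0∞) ≤ ((b + ‖z‖).toNNReal : ℝ≥0∞)} := by
    intro z hz
    rw [mem_compl_iff, mem_closedBall_zero_iff, not_le] at hz
    refine ENNReal.coe_le_coe.2 ((Real.le_toNNReal_iff_coe_le' (by positivity)).2 ?_)
    push_cast
    linarith
  refine (measure_mono hsub).trans ?_
  have hmeas : Measurable fun z : E => ((b + ‖z‖).toNNReal : ℝ≥0∞) := by fun_prop
  refine (meas_ge_le_lintegral_div hmeas.aemeasurable (by simp) ENNReal.coe_ne_top).trans ?_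
  refine ENNReal.div_le_of_le_mul ((hT m hm).trans ?_)
  rw [← ENNReal.coe_mul, ENNReal.coe_le_coe, ← NNReal.coe_le_coe]
  push_cast
  have : (ε : ℝ) * (A / ε + 1) = A + ε := by field_simp
  linarith

variable {d : ℕ}

/-- Probability measures on `ℝ^d × ℝ^d × ℝ^d` whose first two marginals are `μ` and `ν` and for
which the third coordinate is uniformly integrable, as witnessed by the bounds
`∫ (b n + n ‖z‖)⁺ dπ ≤ A`. -/
def youngSet (μ ν : ProbabilityMeasure (Euc d)) (b : ℕ → ℝ) (A : NNReal) :
    Set (ProbabilityMeasure ((Euc d × Euc d) × Euc d)) :=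
  {π | Measure.map (fun x => x.1.1) (π : Measure ((Euc d × Euc d) × Euc d)) = μ ∧
    Measure.map (fun x => x.1.2) (π : Measure ((Euc d × Euc d) × Euc d)) = ν ∧
    ∀ n : ℕ, ∫⁻ x, (b n + n * ‖x.2‖).toNNReal ∂(π : Measure ((Euc d × Euc d) × Euc d)) ≤ A}

variable {μ ν : ProbabilityMeasure (Euc d)} {b : ℕ → ℝ} {A : NNReal}

theorem isClosed_setOf_map_eq {X Y : Type*} [MeasurableSpace X] [TopologicalSpace X]
    [OpensMeasurableSpace X] [MeasurableSpace Y] [TopologicalSpace Y] [BorelSpace Y]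
    [HasOuterApproxClosed Y] {f : X → Y} (hf : Continuous f) (μ : ProbabilityMeasure Y) :
    IsClosed {π : ProbabilityMeasure X | Measure.map f (π : Measure X) = μ} := by
  have h := (isClosed_singleton (x := μ)).preimage (ProbabilityMeasure.continuous_map hf)
  convert h using 1
  ext π
  exact ⟨fun hπ => Subtype.ext hπ, fun hπ => congrArg Subtype.val hπ⟩

/-- `youngSet` is tight, because the first two marginals are fixed and the moment for `n = 1` is
bounded, so it is compact by Prokhorov's theorem. -/
theorem isCompact_youngSet (μ ν : ProbabilityMeasure (Euc d)) (b : ℕ → ℝ) (A : NNReal) :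
    IsCompact (youngSet μ ν b A) := by
  have hclosed : IsClosed (youngSet μ ν b A) := by
    refine (isClosed_setOf_map_eq (by fun_prop) μ).inter
      ((isClosed_setOf_map_eq (by fun_prop) ν).inter ?_)
    have : {π : ProbabilityMeasure ((Euc d × Euc d) × Euc d) | ∀ n : ℕ,
        ∫⁻ x, (b n + n * ‖x.2‖).toNNReal ∂(π : Measure ((Euc d × Euc d) × Euc d)) ≤ A} =
        ⋂ n : ℕ, {π : ProbabilityMeasure ((Euc d × Euc d) × Euc d) |
          ∫⁻ x, (b n + n * ‖x.2‖).toNNReal ∂(π : Measure ((Euc d × Euc d) × Euc d)) ≤ A} := by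
      ext
      simp
    change IsClosed {π : ProbabilityMeasure ((Euc d × Euc d) × Euc d) | ∀ n : ℕ,
        ∫⁻ x, (b n + n * ‖x.2‖).toNNReal ∂(π : Measure ((Euc d × Euc d) × Euc d)) ≤ A}
    rw [this]
    exact isClosed_iInter fun n => isClosed_setOf_lintegral_le (by fun_prop) A
  rw [← hclosed.closure_eq]
  refine isCompact_closure_of_isTightMeasureSet ?_
  have hsing : ∀ (T : Set (Measure (Euc d))) (m : ProbabilityMeasure (Euc d)),
      (∀ m' ∈ T, m' = m) → IsTightMeasureSet T := fun T m hT =>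
    (isTightMeasureSet_singleton (μ := (m : Measure (Euc d)))).subset fun m' hm' => hT m' hm'
  refine IsTightMeasureSet.prodMk (IsTightMeasureSet.prodMk (hsing _ μ ?_) (hsing _ ν ?_))
    (isTightMeasureSet_of_lintegral_norm_le (b := b 1) (A := A) ?_)
  · rintro - ⟨-, ⟨-, ⟨π, hπ, rfl⟩, rfl⟩, rfl⟩
    rw [Measure.fst, Measure.fst, Measure.map_map measurable_fst measurable_fst]
    exact hπ.1
  · rintro - ⟨-, ⟨-, ⟨π, hπ, rfl⟩, rfl⟩, rfl⟩
    rw [Measure.fst, Measure.snd, Measure.map_map measurable_snd measurable_fst]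
    exact hπ.2.1
  · rintro - ⟨-, ⟨π, hπ, rfl⟩, rfl⟩
    rw [Measure.snd, lintegral_map (by fun_prop) measurable_snd]
    simpa using hπ.2.2 1

theorem integrable_moment_of_mem_youngSet {π : ProbabilityMeasure ((Euc d × Euc d) × Euc d)}
    (hπ : π ∈ youngSet μ ν b A) (n : ℕ) :
    Integrable (fun x : (Euc d × Euc d) × Euc d => ((b n + n * ‖x.2‖).toNNReal : ℝ))
        (π : Measure ((Euc d × Euc d) × Euc d)) ∧
      ∫ x, ((b n + n * ‖x.2‖).toNNReal : ℝ) ∂(π : Measure ((Euc d × Euc d) × Euc d)) ≤ A := by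
  have h : ∀ x : (Euc d × Euc d) × Euc d, ‖((b n + n * ‖x.2‖).toNNReal : ℝ)‖ₑ =
      ((b n + n * ‖x.2‖).toNNReal : ℝ≥0∞) := fun x => by
    rw [Real.enorm_eq_ofReal (NNReal.coe_nonneg _), ENNReal.ofReal_coe_nnreal]
  constructor
  · refine ⟨by fun_prop, ?_⟩
    simp only [HasFiniteIntegral, h]
    exact (hπ.2.2 n).trans_lt ENNReal.coe_lt_top
  · rw [integral_eq_lintegral_of_nonneg_ae (Eventually.of_forall fun x => NNReal.coe_nonneg _)
      (by fun_prop)]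
    refine ENNReal.toReal_le_of_le_ofReal A.coe_nonneg ?_
    simp only [ENNReal.ofReal_coe_nnreal]
    exact hπ.2.2 n

theorem integrable_snd_of_mem_youngSet {π : ProbabilityMeasure ((Euc d × Euc d) × Euc d)}
    (hπ : π ∈ youngSet μ ν b A) :
    Integrable (fun x => x.2) (π : Measure ((Euc d × Euc d) × Euc d)) := by
  have h1 := (integrable_moment_of_mem_youngSet hπ 1).1
  simp only [Nat.cast_one, one_mul] at h1
  refine Integrable.mono' (h1.add (integrable_const |b 1|)) (by fun_prop)
    (Eventually.of_forall fun x => ?_)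
  have h2 := Real.le_coe_toNNReal (b 1 + ‖x.2‖)
  change ‖x.2‖ ≤ ((b 1 + ‖x.2‖).toNNReal : ℝ) + |b 1|
  linarith [neg_abs_le (b 1)]

/-- Radial truncation of a vector at norm `R`. -/
def truncate {E : Type*} [NormedAddCommGroup E] [NormedSpace ℝ E] (R : ℝ) (z : E) : E :=
  (R / max R ‖z‖) • z

theorem truncate_of_norm_le {E : Type*} [NormedAddCommGroup E] [NormedSpace ℝ E] {R : ℝ}
    (hR : 0 < R) {z : E} (hz : ‖z‖ ≤ R) : truncate R z = z := by
  rw [truncate, max_eq_left hz, div_self hR.ne', one_smul]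

theorem norm_truncate_le {E : Type*} [NormedAddCommGroup E] [NormedSpace ℝ E] {R : ℝ}
    (hR : 0 < R) (z : E) : ‖truncate R z‖ ≤ R := by
  have hmax : 0 < max R ‖z‖ := lt_max_of_lt_left hR
  rw [truncate, norm_smul, Real.norm_of_nonneg (by positivity), div_mul_eq_mul_div,
    div_le_iff₀ hmax]
  exact mul_le_mul_of_nonneg_left (le_max_right _ _) hR.le

theorem norm_sub_truncate_le {E : Type*} [NormedAddCommGroup E] [NormedSpace ℝ E] {R : ℝ}
    (hR : 0 < R) (z : E) : ‖z - truncate R z‖ ≤ ‖z‖ := by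
  have hmax : 0 < max R ‖z‖ := lt_max_of_lt_left hR
  have h1 : z - truncate R z = (1 - R / max R ‖z‖) • z := by
    rw [truncate, sub_smul, one_smul]
  have h2 : R / max R ‖z‖ ≤ 1 := (div_le_one hmax).2 (le_max_left _ _)
  have h3 : 0 ≤ R / max R ‖z‖ := by positivity
  rw [h1, norm_smul, Real.norm_of_nonneg (by linarith)]
  exact mul_le_of_le_one_left (norm_nonneg _) (by linarith)

theorem continuous_truncate {E : Type*} [NormedAddCommGroup E] [NormedSpace ℝ E] {R : ℝ}
    (hR : 0 < R) : Continuous (truncate R : E → E) := by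
  unfold truncate
  refine Continuous.smul (Continuous.div (by fun_prop) (by fun_prop) fun z => ?_) continuous_id
  exact (lt_max_of_lt_left hR).ne'

/-- Where the truncation at level `1 + 2|b|` acts, the slope `n` dominates the constant `b`. -/
theorem norm_sub_truncate_le_toNNReal {E : Type*} [NormedAddCommGroup E] [NormedSpace ℝ E]
    {n : ℕ} (hn : 1 ≤ n) (b : ℝ) (z : E) :
    ‖z - truncate (1 + 2 * |b|) z‖ ≤ 2 / n * ((b + n * ‖z‖).toNNReal : ℝ) := by
  have hR : 0 < 1 + 2 * |b| := by positivity
  have hn' : (1 : ℝ) ≤ n := by exact_mod_cast hn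
  rcases le_total ‖z‖ (1 + 2 * |b|) with hz | hz
  · rw [truncate_of_norm_le hR hz, sub_self, norm_zero]
    positivity
  · refine (norm_sub_truncate_le hR z).trans ?_
    rw [div_mul_eq_mul_div, le_div_iff₀ (by linarith)]
    have h1 := Real.le_coe_toNNReal (b + n * ‖z‖)
    nlinarith [neg_abs_le b, norm_nonneg z]

/-- On measures with uniformly integrable last coordinate, integrals that grow linearly in that
coordinate are weakly continuous, as uniform limits of integrals of truncations. -/
theorem continuousOn_integral_inner_snd (Φ : (Euc d × Euc d) →ᵇ Euc d) :
    ContinuousOn (fun π : ProbabilityMeasure ((Euc d × Euc d) × Euc d) =>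
      ∫ x, ⟪Φ x.1, x.2⟫ ∂(π : Measure ((Euc d × Euc d) × Euc d))) (youngSet μ ν b A) := by
  set R : ℕ → ℝ := fun n => 1 + 2 * |b n| with hR
  have hRpos : ∀ n, 0 < R n := fun n => by positivity
  let g : ℕ → ((Euc d × Euc d) × Euc d) →ᵇ ℝ := fun n =>
    BoundedContinuousFunction.ofNormedAddCommGroup
      (fun x => ⟪Φ x.1, truncate (R n) x.2⟫)
      ((Φ.continuous.comp continuous_fst).inner
        ((continuous_truncate (hRpos n)).comp continuous_snd)) (‖Φ‖ * R n)
      fun x => (norm_inner_le_norm _ _).trans (mul_le_mul (Φ.norm_coe_le_norm _)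
        (norm_truncate_le (hRpos n) _) (norm_nonneg _) (norm_nonneg _))
  have hunif : TendstoUniformlyOn
      (fun n (π : ProbabilityMeasure ((Euc d × Euc d) × Euc d)) =>
        ∫ x, g n x ∂(π : Measure ((Euc d × Euc d) × Euc d)))
      (fun π => ∫ x, ⟪Φ x.1, x.2⟫ ∂(π : Measure ((Euc d × Euc d) × Euc d))) atTop
      (youngSet μ ν b A) := by
    rw [Metric.tendstoUniformlyOn_iff]
    intro ε hε
    have hlim : Tendsto (fun n : ℕ => ‖Φ‖ * (2 * A) * (1 / (n : ℝ))) atTop (𝓝 0) := by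
      simpa using tendsto_one_div_atTop_nhds_zero_nat.const_mul (‖Φ‖ * (2 * (A : ℝ)))
    filter_upwards [hlim.eventually_lt_const hε, eventually_ge_atTop 1] with n hn hn1 π hπ
    have hint := integrable_snd_of_mem_youngSet hπ
    have hΦm : StronglyMeasurable fun x : (Euc d × Euc d) × Euc d => Φ x.1 :=
      (Φ.continuous.comp continuous_fst).stronglyMeasurable
    have hi1 : Integrable (fun x => ⟪Φ x.1, x.2⟫) (π : Measure ((Euc d × Euc d) × Euc d)) :=
      integrable_inner_of_bounded hint hΦm fun x => Φ.norm_coe_le_norm _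
    rw [dist_eq_norm, ← integral_sub hi1 ((g n).integrable _)]
    obtain ⟨hw, hwle⟩ := integrable_moment_of_mem_youngSet hπ n
    calc ‖∫ x, (⟪Φ x.1, x.2⟫ - g n x) ∂(π : Measure ((Euc d × Euc d) × Euc d))‖
        ≤ ∫ x, ‖Φ‖ * (2 / n * ((b n + n * ‖x.2‖).toNNReal : ℝ))
            ∂(π : Measure ((Euc d × Euc d) × Euc d)) := by
          refine norm_integral_le_of_norm_le ((hw.const_mul _).const_mul _)
            (Eventually.of_forall fun x => ?_)
          change ‖⟪Φ x.1, x.2⟫ - ⟪Φ x.1, truncate (R n) x.2⟫‖ ≤ _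
          rw [← inner_sub_right]
          exact (norm_inner_le_norm _ _).trans (mul_le_mul (Φ.norm_coe_le_norm _)
            (norm_sub_truncate_le_toNNReal hn1 (b n) x.2) (norm_nonneg _) (norm_nonneg _))
      _ = ‖Φ‖ * (2 / n * ∫ x, ((b n + n * ‖x.2‖).toNNReal : ℝ)
            ∂(π : Measure ((Euc d × Euc d) × Euc d))) := by
          rw [integral_const_mul, integral_const_mul]
      _ ≤ ‖Φ‖ * (2 / n * A) := by gcongr
      _ = ‖Φ‖ * (2 * A) * (1 / (n : ℝ)) := by ring
      _ < ε := hn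
  exact hunif.continuousOn (Eventually.of_forall fun n =>
    (ProbabilityMeasure.continuous_integral_boundedContinuousFunction
      (g n)).continuousOn).frequently

/-- The pair `(γ, q)` of a probability measure `π` on `ℝ^d × ℝ^d × ℝ^d`: `γ` is the marginal on
`ℝ^d × ℝ^d` and `q` is the marginal of `z π`. -/
def youngPair (π : ProbabilityMeasure ((Euc d × Euc d) × Euc d)) : Pairs d :=
  ((Measure.map Prod.fst (π : Measure ((Euc d × Euc d) × Euc d))).toSignedMeasure,
    ((π : Measure ((Euc d × Euc d) × Euc d)).withDensityᵥ fun x => x.2).map Prod.fst)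

theorem continuousOn_youngPair : ContinuousOn youngPair (youngSet μ ν b A) := by
  refine ContinuousOn.prodMk ?_ ?_
  · rw [continuousOn_weakTopology_iff]
    intro φ
    refine (ContinuousOn.congr (f := fun π : ProbabilityMeasure ((Euc d × Euc d) × Euc d) =>
      ∫ x, φ x.1 ∂(π : Measure ((Euc d × Euc d) × Euc d))) ?_ fun π _ => ?_)
    · exact (ProbabilityMeasure.continuous_integral_boundedContinuousFunction
        (φ.compContinuous ⟨Prod.fst, continuous_fst⟩)).continuousOn
    · rw [integral_toSignedMeasure_innerSL _ φ.continuous.stronglyMeasurable φ.norm_coe_le_norm]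
      exact integral_map measurable_fst.aemeasurable φ.continuous.aestronglyMeasurable
  · rw [continuousOn_weakTopology_iff]
    intro Φ
    refine (continuousOn_integral_inner_snd Φ).congr fun π hπ => ?_
    have hint := integrable_snd_of_mem_youngSet hπ
    have hΦm : StronglyMeasurable fun x : (Euc d × Euc d) × Euc d => Φ x.1 :=
      (Φ.continuous.comp continuous_fst).stronglyMeasurable
    simp only
    rw [VectorMeasure.integral_map measurable_fst Φ.continuous.aestronglyMeasurable
      (integrable_withDensity_variation hint hΦm fun x => Φ.norm_coe_le_norm _)]
    exact integral_withDensityᵥ_inner hint hΦm fun x => Φ.norm_coe_le_norm _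

end YoungMeasures

/-! ### Compactness of the sublevel sets and existence of solutions -/

section Compactness

theorem lintegral_toENNReal_le_of_erealIntegral_le {Ω : Type*} [MeasurableSpace Ω] {m : Measure Ω}
    [IsProbabilityMeasure m] {f : Ω → EReal} {K : NNReal}
    (hK : ∀ᵐ ω ∂m, ((-K : ℝ) : EReal) ≤ f ω) {B : ℝ} (hB : erealIntegral m f ≤ B) :
    ∫⁻ ω, (f ω).toENNReal ∂m ≤ ((B + K).toNNReal : ℝ≥0∞) := by
  have hN : ∫⁻ ω, (-f ω).toENNReal ∂m ≤ K := by
    have h1 : ∫⁻ _, (K : ℝ≥0∞) ∂m = K := by simp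
    rw [← h1]
    refine lintegral_mono_ae ?_
    filter_upwards [hK] with ω hω
    have h2 : -f ω ≤ ((K : ℝ) : EReal) := by
      rw [EReal.neg_le, ← EReal.coe_neg]
      exact hω
    refine (EReal.toENNReal_le_toENNReal h2).trans ?_
    rw [EReal.toENNReal_of_ne_top (EReal.coe_ne_top _), EReal.toReal_coe,
      ENNReal.ofReal_coe_nnreal]
  have hNtop : ∫⁻ ω, (-f ω).toENNReal ∂m ≠ ⊤ := ne_top_of_le_ne_top ENNReal.coe_ne_top hN
  unfold erealIntegral at hB
  rw [EReal.sub_le_iff_le_add (Or.inl (by simp)) (Or.inl (by simpa using hNtop))] at hB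
  have h3 : ((∫⁻ ω, (f ω).toENNReal ∂m : ℝ≥0∞) : EReal) ≤ ((B + K : ℝ) : EReal) := by
    refine hB.trans ?_
    rw [EReal.coe_add]
    exact add_le_add_right (EReal.coe_ennreal_le_coe_ennreal_iff.2 hN) _
  have h4 : ((∫⁻ ω, (f ω).toENNReal ∂m : ℝ≥0∞) : EReal) ≤
      ((ENNReal.ofReal (B + K) : ℝ≥0∞) : EReal) := by
    rw [EReal.coe_ennreal_ofReal]
    exact h3.trans (EReal.coe_le_coe_iff.2 (le_max_left _ _))
  exact EReal.coe_ennreal_le_coe_ennreal_iff.1 h4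

theorem map_toSignedMeasure {X Y : Type*} [MeasurableSpace X] [MeasurableSpace Y] (m : Measure X)
    [IsFiniteMeasure m] {f : X → Y} (hf : Measurable f) :
    m.toSignedMeasure.map f = (m.map f).toSignedMeasure := by
  ext s hs
  rw [VectorMeasure.map_apply _ hf hs, Measure.toSignedMeasure_apply_measurable (hf hs),
    Measure.toSignedMeasure_apply_measurable hs, Measure.real, Measure.real,
    Measure.map_apply hf hs]

variable {d : ℕ} {μ ν : ProbabilityMeasure (Euc d)} {c : Euc d → Euc d → Euc d → EReal}

theorem map_variation_of_map_eq {γ : SignedMeasure (Euc d × Euc d)} (hγ : 0 ≤ γ)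
    {f : Euc d × Euc d → Euc d} (hf : Measurable f) {m : Measure (Euc d)} [IsFiniteMeasure m]
    (h : γ.map f = m.toSignedMeasure) : Measure.map f γ.variation = m := by
  obtain ⟨_, hv⟩ := variation_of_nonneg γ hγ
  rw [← Measure.toSignedMeasure_eq_toSignedMeasure_iff, ← map_toSignedMeasure _ hf, hv, h]

/-- An admissible pair of bounded cost comes from the measure `(ω ↦ (ω, dq/dγ(ω)))#γ`, whose last
coordinate is uniformly integrable by superlinearity of the cost. -/
theorem exists_youngPair_eq {p : Pairs d} (hp : p ∈ GamQ μ ν) {K : NNReal}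
    (hK : ∀ ω ∈ suppProd μ ν, ∀ z, ((-K : ℝ) : EReal) ≤ c ω.1 ω.2 z) {b : ℕ → ℝ}
    (hb : ∀ n : ℕ, ∀ ω ∈ suppProd μ ν, ∀ z, ((b n + n * ‖z‖ : ℝ) : EReal) ≤ c ω.1 ω.2 z) {B : ℝ}
    (hB : cost c p ≤ B) : ∃ π ∈ youngSet μ ν b (B + K).toNNReal, youngPair π = p := by
  obtain ⟨⟨hcar, hpos, hfst, hsnd⟩, -, hac⟩ := hp
  obtain ⟨hv, hint, hq⟩ := variation_and_density hpos hac
  have hm1 := map_variation_of_map_eq hpos measurable_fst hfst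
  have hm2 := map_variation_of_map_eq hpos measurable_snd hsnd
  unfold cost at hB
  set m : Measure (Euc d × Euc d) := p.1.variation with hm
  set Z : Euc d × Euc d → Euc d := vecRnDeriv p.2 m with hZdef
  have hZ : Measurable Z := measurable_vecRnDeriv _ _
  have hprob : IsProbabilityMeasure m := by
    refine ⟨?_⟩
    have h1 : Measure.map Prod.fst m univ = 1 := by
      rw [hm1]
      exact measure_univ
    rwa [Measure.map_apply measurable_fst MeasurableSet.univ] at h1
  have hae : ∀ᵐ ω ∂m, ω ∈ suppProd μ ν := hcar
  have hG : Measurable fun ω => (ω, Z ω) := measurable_id.prodMk hZ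
  let π : ProbabilityMeasure ((Euc d × Euc d) × Euc d) :=
    ⟨m.map fun ω => (ω, Z ω), Measure.isProbabilityMeasure_map hG.aemeasurable⟩
  have hπ : (π : Measure ((Euc d × Euc d) × Euc d)) = m.map fun ω => (ω, Z ω) := rfl
  have hcost := lintegral_toENNReal_le_of_erealIntegral_le
    (hae.mono fun ω hω => hK ω hω (Z ω)) hB
  refine ⟨π, ⟨?_, ?_, fun n => ?_⟩, Prod.ext ?_ ?_⟩
  · rw [hπ, Measure.map_map (by fun_prop) hG]
    exact hm1
  · rw [hπ, Measure.map_map (by fun_prop) hG]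
    exact hm2
  · rw [hπ, lintegral_map (by fun_prop) hG]
    refine (lintegral_mono_ae ?_).trans hcost
    filter_upwards [hae] with ω hω
    have h1 := EReal.toENNReal_le_toENNReal (hb n ω hω (Z ω))
    rwa [EReal.toENNReal_of_ne_top (EReal.coe_ne_top _), EReal.toReal_coe] at h1
  · have h1 : Measure.map Prod.fst (π : Measure ((Euc d × Euc d) × Euc d)) = m := by
      rw [hπ, Measure.map_map measurable_fst hG]
      exact Measure.map_id
    change (Measure.map Prod.fst (π : Measure ((Euc d × Euc d) × Euc d))).toSignedMeasure = p.1
    simp_rw [h1]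
    exact hv
  · change ((π : Measure ((Euc d × Euc d) × Euc d)).withDensityᵥ fun x => x.2).map Prod.fst = p.2
    rw [← hq]
    have hi : Integrable (fun x => x.2) (π : Measure ((Euc d × Euc d) × Euc d)) := by
      rw [hπ, integrable_map_measure (by fun_prop) hG.aemeasurable]
      exact hint
    ext1 s hs
    rw [VectorMeasure.map_apply _ measurable_fst hs, withDensityᵥ_apply hint hs,
      withDensityᵥ_apply hi (measurable_fst hs), hπ,
      setIntegral_map (measurable_fst hs) (by fun_prop) hG.aemeasurable]
    rfl

theorem measure_compl_suppProd {m : Measure (Euc d × Euc d)} (hm1 : Measure.map Prod.fst m = μ)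
    (hm2 : Measure.map Prod.snd m = ν) : m (suppProd μ ν)ᶜ = 0 := by
  have hX : m (Prod.fst ⁻¹' ((μ : Measure (Euc d)).support)ᶜ) = 0 := by
    rw [← Measure.map_apply measurable_fst Measure.isClosed_support.measurableSet.compl, hm1]
    exact Measure.measure_compl_support
  have hY : m (Prod.snd ⁻¹' ((ν : Measure (Euc d)).support)ᶜ) = 0 := by
    rw [← Measure.map_apply measurable_snd Measure.isClosed_support.measurableSet.compl, hm2]
    exact Measure.measure_compl_support
  refine measure_mono_null (fun ω hω => ?_) (measure_union_null hX hY)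
  by_contra hcon
  rw [mem_union, not_or] at hcon
  exact hω ⟨not_not.1 hcon.1, not_not.1 hcon.2⟩

/-- Admissibility of a pair whose first component comes from a positive measure with the right
marginals. The supports need not be checked: they are controlled by the marginals. -/
theorem mem_GamQ_of_measure {m : Measure (Euc d × Euc d)} [IsFiniteMeasure m]
    {q : VectorMeasure (Euc d × Euc d) (Euc d)} (hm1 : Measure.map Prod.fst m = μ)
    (hm2 : Measure.map Prod.snd m = ν) (hq : ∀ s, MeasurableSet s → m s = 0 → q s = 0)
    (h1 : q.map Prod.fst = (μ : Measure (Euc d)).withDensityᵥ (fun x => x))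
    (h2 : q.map Prod.snd = (ν : Measure (Euc d)).withDensityᵥ (fun y => y)) :
    ((m.toSignedMeasure, q) : Pairs d) ∈ GamQ μ ν := by
  have hS : MeasurableSet (suppProd μ ν) := (isClosed_suppProd μ ν).measurableSet
  have hmS := measure_compl_suppProd hm1 hm2
  refine ⟨⟨?_, Measure.zero_le_toSignedMeasure m, ?_, ?_⟩, ⟨?_, h1, h2⟩, ?_⟩
  · rw [mem_carriedBy_iff hS]
    intro t ht htm
    rw [Measure.toSignedMeasure_apply_measurable htm, Measure.real, measure_mono_null ht hmS,
      ENNReal.toReal_zero]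
  · rw [map_toSignedMeasure _ measurable_fst]
    simp_rw [hm1]
  · rw [map_toSignedMeasure _ measurable_snd]
    simp_rw [hm2]
  · rw [mem_carriedBy_iff hS]
    exact fun t ht htm => hq t htm (measure_mono_null ht hmS)
  · refine VectorMeasure.AbsolutelyContinuous.mk fun s hs hzero => hq s hs ?_
    rw [Measure.toSignedMeasure_apply_measurable hs, measureReal_eq_zero_iff] at hzero
    exact hzero

/-- Conversely `youngPair` produces admissible pairs, up to the marginal constraints on `q`. -/
theorem youngPair_mem_GamQ {π : ProbabilityMeasure ((Euc d × Euc d) × Euc d)} {b : ℕ → ℝ}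
    {A : NNReal} (hπ : π ∈ youngSet μ ν b A)
    (h1 : (youngPair π).2.map Prod.fst = (μ : Measure (Euc d)).withDensityᵥ (fun x => x))
    (h2 : (youngPair π).2.map Prod.snd = (ν : Measure (Euc d)).withDensityᵥ (fun y => y)) :
    youngPair π ∈ GamQ μ ν := by
  refine mem_GamQ_of_measure ?_ ?_ (fun s hs hms => ?_) h1 h2
  · rw [Measure.map_map measurable_fst measurable_fst]
    exact hπ.1
  · rw [Measure.map_map measurable_snd measurable_fst]
    exact hπ.2.1
  · change ((π : Measure ((Euc d × Euc d) × Euc d)).withDensityᵥ fun x => x.2).map Prod.fst s = 0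
    rw [VectorMeasure.map_apply _ measurable_fst hs,
      withDensityᵥ_apply (integrable_snd_of_mem_youngSet hπ) (measurable_fst hs)]
    rw [Measure.map_apply measurable_fst hs] at hms
    exact setIntegral_measure_zero _ hms

/-- Prescribing the image of a vector measure under a continuous map is a closed condition. -/
theorem isClosed_setOf_vectorMeasure_map_eq {f : Euc d × Euc d → Euc d} (hf : Continuous f)
    (τ : VectorMeasure (Euc d) (Euc d)) :
    IsClosed {q : VectorMeasure (Euc d × Euc d) (Euc d) | q.map f = τ} := by
  have hset : {q : VectorMeasure (Euc d × Euc d) (Euc d) | q.map f = τ} =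
      ⋂ Ψ : Euc d →ᵇ Euc d, {q | q.integral (fun ω => Ψ (f ω)) (innerSL ℝ) =
        τ.integral (fun x => Ψ x) (innerSL ℝ)} := by
    have hmap : ∀ (q : VectorMeasure (Euc d × Euc d) (Euc d)) (Ψ : Euc d →ᵇ Euc d),
        (q.map f).integral (fun x => Ψ x) (innerSL ℝ) =
          q.integral (fun ω => Ψ (f ω)) (innerSL ℝ) := fun q Ψ =>
      VectorMeasure.integral_map hf.measurable Ψ.continuous.aestronglyMeasurable
        ((Ψ.compContinuous ⟨f, hf⟩).integrable _)
    ext q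
    simp only [mem_ofPred_eq, mem_iInter]
    constructor
    · rintro rfl Ψ
      exact (hmap q Ψ).symm
    · intro h
      refine ext_of_integral_boundedContinuous fun Ψ => ?_
      rw [hmap]
      exact h Ψ
  rw [hset]
  exact isClosed_iInter fun Ψ => isClosed_eq
    (continuous_integral_boundedContinuous (Ψ.compContinuous ⟨f, hf⟩)) continuous_const

/-- A sublevel set is the part of the compact set `youngPair '' youngSet μ ν b A` on which the
marginals of `q` are prescribed and all pairings with minorants are at most `B`. -/
theorem isCompact_sublevel
    (hc : CostConditions (μ : Measure (Euc d)).support (ν : Measure (Euc d)).support c) (B : ℝ) :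
    IsCompact {p ∈ GamQ μ ν | cost c p ≤ (B : EReal)} := by
  obtain ⟨K, hK⟩ := hc.superlinearIntegrand.exists_nnreal_le
  choose b hb using fun n : ℕ => hc.superlinearIntegrand.growth n
  let V : Set (Pairs d) := {p | ∀ P ∈ costMinorants μ ν c, pairing P p.1 p.2 ≤ B} ∩
    ({p | p.2.map Prod.fst = (μ : Measure (Euc d)).withDensityᵥ (fun x => x)} ∩
      {p | p.2.map Prod.snd = (ν : Measure (Euc d)).withDensityᵥ (fun y => y)})
  have hV : IsClosed V := by
    refine IsClosed.inter ?_ (IsClosed.inter ?_ ?_)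
    · simp only [ofPred_forall]
      exact isClosed_biInter fun P _ => isClosed_le (continuous_pairing P) continuous_const
    · exact (isClosed_setOf_vectorMeasure_map_eq continuous_fst _).preimage continuous_snd
    · exact (isClosed_setOf_vectorMeasure_map_eq continuous_snd _).preimage continuous_snd
  have heq : {p ∈ GamQ μ ν | cost c p ≤ (B : EReal)} =
      youngPair '' youngSet μ ν b (B + K).toNNReal ∩ V := by
    ext p
    constructor
    · rintro ⟨hp, hpB⟩
      refine ⟨exists_youngPair_eq hp hK hb hpB, fun P hP => ?_, hp.2.1.2.1, hp.2.1.2.2⟩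
      have h1 := pairing_le_functional hc (GamQ_subset_pairsOn hp) hP
      rw [functional_eq_cost hp] at h1
      exact EReal.coe_le_coe_iff.1 (h1.trans hpB)
    · rintro ⟨⟨π, hπ, rfl⟩, hB, h1, h2⟩
      have hp : youngPair π ∈ GamQ μ ν := youngPair_mem_GamQ hπ h1 h2
      refine ⟨hp, ?_⟩
      rw [← functional_eq_cost hp]
      exact functional_le_of_forall_pairing_le hc (GamQ_subset_pairsOn hp) hB
  rw [heq]
  exact ((isCompact_youngSet μ ν b _).image_of_continuousOn continuousOn_youngPair).inter_right hV

theorem exists_isSolution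
    (hc : CostConditions (μ : Measure (Euc d)).support (ν : Measure (Euc d)).support c)
    (hfin : infimum c μ ν < ⊤) : ∃ p, IsSolution c μ ν p := by
  obtain ⟨B, hB, -⟩ := EReal.lt_iff_exists_real_btwn.1 hfin
  obtain ⟨p₀, hp₀, hlt⟩ : ∃ p ∈ GamQ μ ν, cost c p < B := by
    simpa [infimum, iInf_lt_iff] using hB
  have hsub : {p ∈ GamQ μ ν | cost c p ≤ (B : EReal)} ⊆ pairsOn μ ν :=
    fun p hp => GamQ_subset_pairsOn hp.1
  have hne : {p ∈ GamQ μ ν | cost c p ≤ (B : EReal)}.Nonempty := ⟨p₀, hp₀, hlt.le⟩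
  obtain ⟨p, hp, hmin⟩ := LowerSemicontinuousOn.exists_isMinOn hne (isCompact_sublevel hc B)
    ((lowerSemicontinuousOn_functional hc).mono hsub)
  refine ⟨p, hp.1, le_antisymm (le_iInf₂ fun p' hp' => ?_) (iInf₂_le p hp.1)⟩
  rcases le_total (cost c p') B with h | h
  · have h1 := hmin ⟨hp', h⟩
    rwa [mem_ofPred_eq, functional_eq_cost hp.1, functional_eq_cost hp'] at h1
  · exact hp.2.trans h

end Compactness

/-! ### Two solutions -/

section NonUniqueness

variable {d : ℕ}

/-- The cost `max (|z|² - 16) 0`, which vanishes for `|z| ≤ 4`. -/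
def flatCost (_ _ z : Euc d) : EReal := ((max (‖z‖ ^ 2 - 16) 0 : ℝ) : EReal)

theorem convexOn_norm_sq_sub : ConvexOn ℝ univ fun z : Euc d => ‖z‖ ^ 2 - 16 :=
  ((convexOn_univ_norm (E := Euc d)).pow (fun z _ => norm_nonneg z) 2).sub
    (concaveOn_const 16 convex_univ)

theorem costConditions_flatCost (X Y : Set (Euc d)) : CostConditions X Y flatCost where
  lsc := by
    have h : Continuous fun p : Euc d × Euc d × Euc d => flatCost p.1 p.2.1 p.2.2 :=
      continuous_coe_real_ereal.comp (by fun_prop)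
    exact h.lowerSemicontinuous.lowerSemicontinuousOn _
  bounded_below := ⟨0, fun x _ y _ z => EReal.coe_le_coe_iff.2 (le_max_right _ _)⟩
  convex := by
    intro x _ y _
    refine ⟨convex_univ, fun z _ w _ a b ha hb hab => ?_⟩
    have h : ConvexOn ℝ univ fun z : Euc d => max (‖z‖ ^ 2 - 16) 0 :=
      convexOn_norm_sq_sub.sup (convexOn_const 0 convex_univ)
    have h1 := h.2 (mem_univ z) (mem_univ w) ha.le hb.le hab
    simp only [flatCost]
    rw [← EReal.coe_mul, ← EReal.coe_mul, ← EReal.coe_add]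
    exact EReal.coe_le_coe_iff.2 h1
  superlinear := by
    refine ⟨fun z => ‖z‖ ^ 2 - 16, convexOn_norm_sq_sub, ?_,
      fun x _ y _ z => EReal.coe_le_coe_iff.2 (le_max_left _ _)⟩
    have h1 : Tendsto (fun z : Euc d => ‖z‖ - 16) (Bornology.cobounded (Euc d)) atTop :=
      tendsto_atTop_add_const_right _ _ tendsto_norm_cobounded_atTop
    refine tendsto_atTop_mono' _ ?_ h1
    filter_upwards [tendsto_norm_cobounded_atTop.eventually_ge_atTop (1 : ℝ)] with z hz
    rw [le_div_iff₀ (by linarith)]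
    nlinarith

/-- The measure `½ (δ_e + δ_{-e})`. -/
def twoPoint (e : Euc d) : ProbabilityMeasure (Euc d) :=
  ⟨(2⁻¹ : ℝ≥0∞) • (Measure.dirac e + Measure.dirac (-e)), ⟨by
    simp only [Measure.smul_apply, Measure.add_apply, measure_univ, smul_eq_mul]
    rw [one_add_one_eq_two]
    exact ENNReal.inv_mul_cancel (by simp) (by simp)⟩⟩

theorem coe_twoPoint (e : Euc d) : (twoPoint e : Measure (Euc d)) =
    (2⁻¹ : ℝ≥0∞) • (Measure.dirac e + Measure.dirac (-e)) := rfl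

theorem ae_twoPoint (e : Euc d) : ∀ᵐ x ∂(twoPoint e : Measure (Euc d)), x = e ∨ x = -e := by
  have hm : MeasurableSet {x : Euc d | x = e ∨ x = -e} :=
    (measurableSet_singleton e).union (measurableSet_singleton (-e))
  rw [coe_twoPoint]
  refine Measure.ae_smul_measure ?_ _
  rw [ae_add_measure_iff]
  exact ⟨(ae_dirac_iff hm).2 (Or.inl rfl), (ae_dirac_iff hm).2 (Or.inr rfl)⟩

theorem integrable_twoPoint (e : Euc d) {f : Euc d → Euc d} (hf : Continuous f) :
    Integrable f (twoPoint e : Measure (Euc d)) := by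
  refine Integrable.of_bound hf.aestronglyMeasurable (max ‖f e‖ ‖f (-e)‖) ?_
  filter_upwards [ae_twoPoint e] with x hx
  rcases hx with rfl | rfl
  exacts [le_max_left _ _, le_max_right _ _]

theorem integral_twoPoint (e : Euc d) (f : Euc d → Euc d) :
    ∫ x, f x ∂(twoPoint e : Measure (Euc d)) = (2⁻¹ : ℝ) • (f e + f (-e)) := by
  have h : ∀ a : Euc d, Integrable f (Measure.dirac a) := fun a => integrable_dirac (by simp)
  rw [coe_twoPoint, integral_smul_measure, integral_add_measure (h _) (h _), integral_dirac,
    integral_dirac]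
  simp

theorem twoPoint_mem_P1 (e : Euc d) : twoPoint e ∈ P1 (0 : Euc d) :=
  ⟨integrable_twoPoint e continuous_id, by rw [integral_twoPoint]; simp⟩

/-- The product coupling of `twoPoint e` with itself. -/
def productPlan (e : Euc d) : Measure (Euc d × Euc d) :=
  (twoPoint e : Measure (Euc d)).prod (twoPoint e : Measure (Euc d))

instance (e : Euc d) : IsProbabilityMeasure (productPlan e) := by
  unfold productPlan
  infer_instance

/-- The density `x + y + t ⟨x, y⟩ e`. Its conditional means given `x` and given `y` under the
product coupling are `x` and `y`, whatever the value of `t`. -/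
def productDensity (e : Euc d) (t : ℝ) (ω : Euc d × Euc d) : Euc d :=
  ω.1 + ω.2 + (t * ⟪ω.1, ω.2⟫) • e

theorem ae_productPlan (e : Euc d) :
    ∀ᵐ ω ∂productPlan e, (ω.1 = e ∨ ω.1 = -e) ∧ (ω.2 = e ∨ ω.2 = -e) := by
  filter_upwards [Measure.quasiMeasurePreserving_fst.ae (ae_twoPoint e),
    Measure.quasiMeasurePreserving_snd.ae (ae_twoPoint e)] with ω h1 h2 using ⟨h1, h2⟩

theorem continuous_productDensity (e : Euc d) (t : ℝ) : Continuous (productDensity e t) := by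
  unfold productDensity
  fun_prop

theorem abs_inner_eq_one {e x y : Euc d} (he : ‖e‖ = 1) (hx : x = e ∨ x = -e)
    (hy : y = e ∨ y = -e) : |⟪x, y⟫| = 1 := by
  have h : ⟪e, e⟫ = 1 := by rw [real_inner_self_eq_norm_sq, he, one_pow]
  rcases hx with rfl | rfl <;> rcases hy with rfl | rfl <;>
    simp [inner_neg_left, inner_neg_right, he]

theorem ae_norm_productDensity_le {e : Euc d} (he : ‖e‖ = 1) (t : ℝ) :
    ∀ᵐ ω ∂productPlan e, ‖productDensity e t ω‖ ≤ 2 + |t| := by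
  have hn : ∀ x : Euc d, x = e ∨ x = -e → ‖x‖ = 1 := by
    rintro x (rfl | rfl)
    exacts [he, by rw [norm_neg, he]]
  filter_upwards [ae_productPlan e] with ω hω
  calc ‖productDensity e t ω‖ ≤ ‖ω.1‖ + ‖ω.2‖ + ‖(t * ⟪ω.1, ω.2⟫) • e‖ := norm_add₃_le
    _ = 2 + |t| := by
      rw [norm_smul, he, Real.norm_eq_abs, abs_mul, abs_inner_eq_one he hω.1 hω.2, hn _ hω.1,
        hn _ hω.2]
      ring

theorem integrable_productDensity {e : Euc d} (he : ‖e‖ = 1) (t : ℝ) :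
    Integrable (productDensity e t) (productPlan e) :=
  Integrable.of_bound (continuous_productDensity e t).aestronglyMeasurable _
    (ae_norm_productDensity_le he t)

/-- The admissible pair with the product coupling and density `productDensity e t`. -/
def productPair (e : Euc d) (t : ℝ) : Pairs d :=
  ((productPlan e).toSignedMeasure, (productPlan e).withDensityᵥ (productDensity e t))

theorem productPair_mem_GamQ {e : Euc d} (he : ‖e‖ = 1) (t : ℝ) :
    productPair e t ∈ GamQ (twoPoint e) (twoPoint e) := by
  have hint := integrable_productDensity he t
  have hid : Integrable (fun x : Euc d => x) (twoPoint e : Measure (Euc d)) :=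
    integrable_twoPoint e continuous_id
  refine mem_GamQ_of_measure ?_ ?_ (fun s hs hms => ?_) ?_ ?_
  · exact (Measure.map_fst_prod.trans (by simp))
  · exact (Measure.map_snd_prod.trans (by simp))
  · rw [withDensityᵥ_apply hint hs]
    exact setIntegral_measure_zero _ hms
  · ext1 s hs
    rw [VectorMeasure.map_apply _ measurable_fst hs, withDensityᵥ_apply hint (measurable_fst hs),
      withDensityᵥ_apply hid hs, ← prod_univ, productPlan,
      setIntegral_prod _ hint.integrableOn, Measure.restrict_univ]
    refine integral_congr_ae (Eventually.of_forall fun x => ?_)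
    simp only [integral_twoPoint, productDensity, inner_neg_right]
    module
  · ext1 s hs
    rw [VectorMeasure.map_apply _ measurable_snd hs, withDensityᵥ_apply hint (measurable_snd hs),
      withDensityᵥ_apply hid hs, ← univ_prod, productPlan,
      ← setIntegral_prod_swap univ s (productDensity e t), setIntegral_prod _ ?_,
      Measure.restrict_univ]
    · refine integral_congr_ae (Eventually.of_forall fun x => ?_)
      simp only [integral_twoPoint, productDensity, inner_neg_left, Prod.fst_swap, Prod.snd_swap]
      module
    · exact hint.swap.integrableOn

theorem cost_productPair {e : Euc d} (he : ‖e‖ = 1) {t : ℝ} (ht : |t| ≤ 2) :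
    cost flatCost (productPair e t) = 0 := by
  have hint := integrable_productDensity he t
  have hp := productPair_mem_GamQ he t
  have hv : (productPair e t).1.variation = productPlan e := by simp [productPair]
  obtain ⟨-, hi, hq⟩ := variation_and_density hp.1.2.1 hp.2.2
  unfold cost
  rw [hv] at hi hq ⊢
  have hae : vecRnDeriv (productPair e t).2 (productPlan e) =ᵐ[productPlan e]
      productDensity e t := hi.ae_eq_of_withDensityᵥ_eq hint hq
  have hzero : (fun ω : Euc d × Euc d => (flatCost ω.1 ω.2
      (vecRnDeriv (productPair e t).2 (productPlan e) ω))) =ᵐ[productPlan e] fun _ => 0 := by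
    filter_upwards [hae, ae_norm_productDensity_le he t] with ω h1 h2
    rw [h1, flatCost, max_eq_right, EReal.coe_zero]
    nlinarith [norm_nonneg (productDensity e t ω)]
  rw [erealIntegral_congr_ae hzero]
  simp [erealIntegral]

theorem cost_flatCost_nonneg (p : Pairs d) : 0 ≤ cost flatCost p := by
  have h : ∀ x y z : Euc d, (-(flatCost x y z)).toENNReal = 0 := fun x y z => by
    refine EReal.toENNReal_of_nonpos ?_
    rw [EReal.neg_le, neg_zero]
    exact EReal.coe_nonneg.2 (le_max_right _ _)
  simp only [cost, erealIntegral, h, lintegral_zero, EReal.coe_ennreal_zero, sub_zero]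
  exact EReal.coe_ennreal_nonneg _

theorem infimum_flatCost {e : Euc d} (he : ‖e‖ = 1) :
    infimum flatCost (twoPoint e) (twoPoint e) = 0 := by
  refine le_antisymm ?_ (le_iInf₂ fun p _ => cost_flatCost_nonneg p)
  exact (iInf₂_le _ (productPair_mem_GamQ he 0)).trans_eq (cost_productPair he (by simp))

theorem productPair_ne {e : Euc d} (he : ‖e‖ = 1) : productPair e 0 ≠ productPair e 1 := by
  intro h
  have hae := (integrable_productDensity he 0).ae_eq_of_withDensityᵥ_eq
    (integrable_productDensity he 1) (congrArg Prod.snd h)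
  obtain ⟨ω, h1, h2⟩ := (hae.and (ae_productPlan e)).exists
  have h3 : ⟪ω.1, ω.2⟫ • e = 0 := by simpa [productDensity] using h1
  have h4 : ‖⟪ω.1, ω.2⟫ • e‖ = 1 := by
    rw [norm_smul, he, Real.norm_eq_abs, abs_inner_eq_one he h2.1 h2.2, mul_one]
  rw [h3, norm_zero] at h4
  exact zero_ne_one h4

end NonUniqueness

end

end BiMOT

theorem mainTheorem9 (d : ℕ) :
    (∀ (b : BiMOT.Euc d) (μ ν : ProbabilityMeasure (BiMOT.Euc d))
        (c : BiMOT.Euc d → BiMOT.Euc d → BiMOT.Euc d → EReal),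
      μ ∈ BiMOT.P1 b → ν ∈ BiMOT.P1 b →
      BiMOT.CostConditions (μ : Measure (BiMOT.Euc d)).support
        (ν : Measure (BiMOT.Euc d)).support c →
      (BiMOT.ERealConvexOn (BiMOT.pairsOn μ ν) (BiMOT.functional c) ∧
        LowerSemicontinuousOn (BiMOT.functional c) (BiMOT.pairsOn μ ν)) ∧
      (∀ C₀ : ℝ, IsCompact {p ∈ BiMOT.GamQ μ ν | BiMOT.cost c p ≤ (C₀ : EReal)}) ∧
      (BiMOT.infimum c μ ν < ⊤ → ∃ p, BiMOT.IsSolution c μ ν p)) ∧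
    (1 ≤ d → ∃ (b : BiMOT.Euc d) (μ ν : ProbabilityMeasure (BiMOT.Euc d))
        (c : BiMOT.Euc d → BiMOT.Euc d → BiMOT.Euc d → EReal),
      μ ∈ BiMOT.P1 b ∧ ν ∈ BiMOT.P1 b ∧
      BiMOT.CostConditions (μ : Measure (BiMOT.Euc d)).support
        (ν : Measure (BiMOT.Euc d)).support c ∧
      BiMOT.infimum c μ ν < ⊤ ∧
      ∃ p p', p ≠ p' ∧ BiMOT.IsSolution c μ ν p ∧ BiMOT.IsSolution c μ ν p') := by
  refine ⟨fun b μ ν c _ _ hc => ⟨⟨BiMOT.convexOn_functional hc,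
    BiMOT.lowerSemicontinuousOn_functional hc⟩, BiMOT.isCompact_sublevel hc,
    BiMOT.exists_isSolution hc⟩, fun hd => ?_⟩
  let e : BiMOT.Euc d := EuclideanSpace.single ⟨0, hd⟩ 1
  have he : ‖e‖ = 1 := by simp [e]
  have hinf := BiMOT.infimum_flatCost he
  refine ⟨0, BiMOT.twoPoint e, BiMOT.twoPoint e, BiMOT.flatCost, BiMOT.twoPoint_mem_P1 e,
    BiMOT.twoPoint_mem_P1 e, BiMOT.costConditions_flatCost _ _, ?_, BiMOT.productPair e 0,
    BiMOT.productPair e 1, BiMOT.productPair_ne he, ⟨BiMOT.productPair_mem_GamQ he 0, ?_⟩,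
    ⟨BiMOT.productPair_mem_GamQ he 1, ?_⟩⟩
  · rw [hinf]
    exact EReal.zero_lt_top
  · rw [hinf, BiMOT.cost_productPair he (by simp)]
  · rw [hinf, BiMOT.cost_productPair he (by simp)]
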